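/- **Notation.** $\|\cdot\|$ is the Euclidean norm; $[x]_\times$ is the skew-symmetric matrix with $[x]_\times y=x\times y$; $e_3=(0,0,1)^\top$; for $R\in\mathbb{SO}(3)$, $|R|\ge 0$ is defined by $|R|^2=\frac14\mathrm{tr}(I_3-R)=\frac18\|I_3-R\|_F^2\in[0,1]$; $\mathbf{sat}_c(x)=\min(1,c/\|x\|)\,x$ (with $\mathbf{sat}_c(0)=0$); and $\mathbf P_c^{\epsilon_b}(\phi,\mu)=\mu$ if $\|\phi\|<c$ or $\phi^\top\mu\le 0$, and $\mathbf P_c^{\epsilon_b}(\phi,\mu)=\big(I_3-\min(1,\tfrac{\|\phi\|-c}{\epsilon_b})\tfrac{\phi\phi^\top}{\|\phi\|^2}\big)\mu$ otherwise. **Vehicle.** $\dot R=R[\omega]_\times$, $\dot p=v$, $\dot v=ge_3+Ra_B$ for $t\ge0$, with $R\in\mathbb{SO}(3)$ and $p,v\in\mathbb R^3$. The measurements are $\omega^y=\omega+b_\omega$, $a_B=R^\top a_I$, $m_B=R^\top m_I$ and $y=C_pp$, where $b_\omega,m_I\in\mathbb R^3$ are constant, $a_I(t)\in\mathbb R^3$,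 and $C_p\in\mathbb R^{m\times3}$ has rank $3$. For constants $c_0,\dots,c_5>0$ and all $t\ge0$: $\|m_I\times a_I(t)\|\ge c_0$; $c_1\le\|a_I(t)\|\le c_2$; $a_I$ is differentiable with $\|\dot a_I(t)\|\le c_3$; $\|\omega(t)\|\le c_4$; $\|b_\omega\|\le c_5$. **Observer.** Put $x=(p,v)$, $A=\begin{bmatrix}0&I_3\\0&0\end{bmatrix}$, $B=\begin{bmatrix}0\\I_3\end{bmatrix}$, $C=[C_p\ \ 0]$, $L_\gamma=\mathrm{blockdiag}(\gamma I_3,\gamma^2I_3)$ and $K=\begin{bmatrix}K_p\\K_v\end{bmatrix}=L_\gamma K_0$, where $K_0\in\mathbb R^{6\times m}$ is such that $A-K_0C$ is Hurwitz. Let $k_b,\rho_1,\rho_2,\epsilon_b>0$ and $\hat c_2>\sqrt8\,c_2$. The observer state $(\hat R,\hat b_\omega,\hat x)\in\mathbb{SO}(3)\times\mathbb R^3\times\mathbb R^6$ satisfies $$\dot{\hat R}=\hat R[\omega^y-\hat b_\omega+k_R\sigma_R]_\times,\qquad \dot{\hat b}_\omega=\mathbf P_{c_5}^{\epsilon_b}(\hat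 b_\omega,-k_b\sigma_R),$$ $$\dot{\hat x}=A\hat x+B(ge_3+\hat Ra_B)+K(y-C\hat x)+\begin{bmatrix}\sigma_p\\\sigma_v\end{bmatrix},$$ $$\sigma_p=k_R(K_vC_p)^{-1}[\hat R\sigma_R]_\times\hat Ra_B,\qquad\sigma_v=K_pC_p\sigma_p,$$ $$\sigma_R=\rho_1(m_B\times\hat R^\top m_I)+\rho_2\big(a_B\times\hat R^\top\mathbf{sat}_{\hat c_2}(K_v(y-C\hat x))\big).$$ The errors are $\tilde R=R\hat R^\top$, $\tilde b_\omega=b_\omega-\hat b_\omega$, $\tilde x=x-\hat x$ and $$\zeta=L_\gamma^{-1}\big[(A-KC)\tilde x+B(I_3-\tilde R)^\top a_I\big].$$ **Theorem 1 (semi-global exponential stability).** Fix $g$, $C_p$, $m_I$, $c_0,\dots,c_5$ and $K_0,k_b,\rho_1,\rho_2,\epsilon_b,\hat c_2$ as above. For every $\epsilon\in(\frac12,1)$ and every $r>0$ there exist $k_R^*>0$ and, for each $k_R$, a number $\gamma^*=\gamma^*(k_R)\ge1$, such that for all $k_R\ge k_R^*$ and all $\gamma\ge\gamma^*(k_R)$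 there are constants $M$, $\kappa>0$ and $\lambda>0$ with the following property. For every vehicle trajectory satisfying the assumptions above with these constants, and every observer solution on an interval $[0,T)$, $0<T\le\infty$, with $\|\zeta(0)\|\le r$, $|\tilde R(0)|\le\epsilon$ and $\|\hat b_\omega(0)\|\le c_5+\epsilon_b$, the error size $\eta(t)=\|\zeta(t)\|+|\tilde R(t)|+\|\tilde b_\omega(t)\|$ satisfies $$\eta(t)\le M\qquad\text{and}\qquad\eta(t)\le\kappa e^{-\lambda t}\eta(0)\qquad\text{for all }t\in[0,T).$$ That is, the errors are uniformly bounded and converge exponentially to zero. -/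

import Mathlib

open Matrix

namespace NavObs

noncomputable section

/-! ### Notation: vectors, the cross-product matrix, attitude distance, saturation, projection -/

/-- Column vectors of `ℝ³`. -/
abbrev V3 : Type := Fin 3 → ℝ

/-- Real `3 × 3` matrices. -/
abbrev M3 : Type := Matrix (Fin 3) (Fin 3) ℝ

/-- Index set of `ℝ⁶ = ℝ³ × ℝ³`; `Sum.inl` is the position block, `Sum.inr` the velocity block. -/
abbrev I6 : Type := Fin 3 ⊕ Fin 3

/-- The Euclidean norm of a real vector. -/
def euc {ι : Type} [Fintype ι] (x : ι → ℝ) : ℝ :=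
  ‖(WithLp.toLp 2 x : EuclideanSpace ℝ ι)‖

/-- The third basis vector. -/
def e3 : V3 := ![0, 0, 1]

/-- The skew-symmetric matrix `[x]_×`. -/
def skew (x : V3) : M3 :=
  !![0, -x 2, x 1;
     x 2, 0, -x 0;
     -x 1, x 0, 0]

theorem skew_mulVec (x y : V3) : skew x *ᵥ y = crossProduct x y := by
  ext i
  fin_cases i <;> simp [skew, cross_apply, Matrix.mulVec, dotProduct, Fin.sum_univ_three] <;> ring

/-- The normalized Euclidean distance `|R|` of a rotation to the identity,
`|R|² = tr (I - R) / 4 = ‖I - R‖_F² / 8`. -/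
def attNorm (R : M3) : ℝ := Real.sqrt ((1 - R).trace / 4)

/-- The saturation `sat_c`. -/
def sat (c : ℝ) (x : V3) : V3 := min 1 (c / euc x) • x

open Classical in
/-- The parameter projection `P_c^ε(φ, μ)`. -/
def proj (c ε : ℝ) (φ μ : V3) : V3 :=
  if euc φ < c ∨ φ ⬝ᵥ μ ≤ 0 then μ
  else (1 - (min 1 ((euc φ - c) / ε) / euc φ ^ 2) • vecMulVec φ φ : M3) *ᵥ μ

/-- A real square matrix all of whose complex eigenvalues have negative real part. -/
def IsHurwitz {ι : Type} [Fintype ι] [DecidableEq ι] (M : Matrix ι ι ℝ) : Prop :=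
  ∀ z ∈ spectrum ℂ (M.map (algebraMap ℝ ℂ)), z.re < 0

/-! ### The vehicle -/

/-- A vehicle: position, velocity, attitude, body angular velocity and inertial apparent
acceleration as functions of time, and the constant gyro bias. -/
structure Vehicle where
  p : ℝ → V3
  v : ℝ → V3
  R : ℝ → M3
  ω : ℝ → V3
  aI : ℝ → V3
  bω : V3

namespace Vehicle

variable (V : Vehicle)

/-- The accelerometer measurement `a_B = Rᵀ a_I`. -/
def aB (t : ℝ) : V3 := (V.R t)ᵀ *ᵥ V.aI t

/-- The gyro measurement `ω_y = ω + b_ω`. -/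
def ωy (t : ℝ) : V3 := V.ω t + V.bω

/-- The magnetometer measurement `m_B = Rᵀ m_I`. -/
def mB (mI : V3) (t : ℝ) : V3 := (V.R t)ᵀ *ᵥ mI

/-- The combined translational state `x = (p, v)`. -/
def x (t : ℝ) : I6 → ℝ := Sum.elim (V.p t) (V.v t)

/-- The rigid-body equations `Ṙ = R[ω]_×`, `ṗ = v`, `v̇ = g e₃ + R a_B` for `t ≥ 0`, with
`R` starting in `SO(3)` (hence remaining there). -/
structure IsMotion (g : ℝ) : Prop where
  R_init : V.R 0 ∈ specialOrthogonalGroup (Fin 3) ℝ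
  dR : ∀ t, 0 ≤ t → HasDerivWithinAt V.R (V.R t * skew (V.ω t)) (Set.Ici 0) t
  dp : ∀ t, 0 ≤ t → HasDerivWithinAt V.p (V.v t) (Set.Ici 0) t
  dv : ∀ t, 0 ≤ t → HasDerivWithinAt V.v (g • e3 + V.R t *ᵥ V.aB t) (Set.Ici 0) t

/-- Uniform non-collinearity of `m_I` and `a_I`. -/
def NonCollinear (mI : V3) (c0 : ℝ) : Prop :=
  ∀ t, 0 ≤ t → c0 ≤ euc (crossProduct mI (V.aI t))

/-- Bounds on the apparent acceleration and on its derivative. -/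
structure BoundedAcc (c1 c2 c3 : ℝ) : Prop where
  lower : ∀ t, 0 ≤ t → c1 ≤ euc (V.aI t)
  upper : ∀ t, 0 ≤ t → euc (V.aI t) ≤ c2
  diff : DifferentiableOn ℝ V.aI (Set.Ici 0)
  deriv_le : ∀ t, 0 ≤ t → euc (derivWithin V.aI (Set.Ici 0) t) ≤ c3

/-- Bounds on the angular velocity and on the gyro bias. -/
structure BoundedRate (c4 c5 : ℝ) : Prop where
  rate : ∀ t, 0 ≤ t → euc (V.ω t) ≤ c4
  bias : euc V.bω ≤ c5

end Vehicle

/-! ### The observer -/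

/-- The system matrix `A`. -/
def matA : Matrix I6 I6 ℝ := fromBlocks 0 1 0 0

/-- The input matrix `B`. -/
def matB : Matrix I6 (Fin 3) ℝ := fromRows 0 1

/-- The output matrix `C = [C_p 0]`. -/
def matC {m : ℕ} (Cp : Matrix (Fin m) (Fin 3) ℝ) : Matrix (Fin m) I6 ℝ := fromCols Cp 0

/-- The scaling matrix `L_γ = blockdiag (γ I₃, γ² I₃)`. -/
def matL (γ : ℝ) : Matrix I6 I6 ℝ := fromBlocks (γ • 1) 0 0 (γ ^ 2 • 1)

/-- The known constants of the observer: gravity `g`, output matrix `C_p`, magnetic field `m_I`,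
the bias bound `c₅`, and the design parameters `K₀, k_b, ρ₁, ρ₂, ε_b, ĉ₂, k_R, γ`. -/
structure Design (m : ℕ) where
  g : ℝ
  Cp : Matrix (Fin m) (Fin 3) ℝ
  mI : V3
  c5 : ℝ
  K0 : Matrix I6 (Fin m) ℝ
  kb : ℝ
  ρ1 : ℝ
  ρ2 : ℝ
  εb : ℝ
  c2hat : ℝ
  kR : ℝ
  γ : ℝ

namespace Design

variable {m : ℕ} (D : Design m)

/-- The gain `K = L_γ K₀`. -/
def K : Matrix I6 (Fin m) ℝ := matL D.γ * D.K0

/-- The upper block of `K`. -/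
def Kp : Matrix (Fin 3) (Fin m) ℝ := D.K.toRows₁

/-- The lower block of `K`. -/
def Kv : Matrix (Fin 3) (Fin m) ℝ := D.K.toRows₂

end Design

/-- Trajectories of the observer state `(R̂, b̂_ω, x̂)`. -/
structure Estimate where
  R : ℝ → M3
  b : ℝ → V3
  x : ℝ → I6 → ℝ

section ClosedLoop

variable {m : ℕ} (D : Design m) (V : Vehicle) (E : Estimate)

/-- The output error `y - C x̂`, where `y = C_p p`. -/
def outErr (t : ℝ) : Fin m → ℝ := D.Cp *ᵥ V.p t - matC D.Cp *ᵥ E.x t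

/-- The attitude innovation `σ_R`. -/
def σR (t : ℝ) : V3 :=
  D.ρ1 • crossProduct (V.mB D.mI t) ((E.R t)ᵀ *ᵥ D.mI) +
    D.ρ2 • crossProduct (V.aB t) ((E.R t)ᵀ *ᵥ sat D.c2hat (D.Kv *ᵥ outErr D V E t))

/-- The position innovation `σ_p`. -/
def σp (t : ℝ) : V3 :=
  D.kR • ((D.Kv * D.Cp)⁻¹ *ᵥ (skew (E.R t *ᵥ σR D V E t) *ᵥ (E.R t *ᵥ V.aB t)))

/-- The velocity innovation `σ_v`. -/
def σv (t : ℝ) : V3 := (D.Kp * D.Cp) *ᵥ σp D V E t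

/-- The translational innovation `σ_x = (σ_p, σ_v)`. -/
def σx (t : ℝ) : I6 → ℝ := Sum.elim (σp D V E t) (σv D V E t)

/-- `E` solves the observer equations, driven by the measurements of `V`, on the time interval
`J` (which starts at `0`), with `R̂(0) ∈ SO(3)` (hence `R̂` stays there). -/
structure IsObserver (J : Set ℝ) : Prop where
  R_init : E.R 0 ∈ specialOrthogonalGroup (Fin 3) ℝ
  dR : ∀ t ∈ J, HasDerivWithinAt E.R
    (E.R t * skew (V.ωy t - E.b t + D.kR • σR D V E t)) J t
  db : ∀ t ∈ J, HasDerivWithinAt E.b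
    (proj D.c5 D.εb (E.b t) (-D.kb • σR D V E t)) J t
  dx : ∀ t ∈ J, HasDerivWithinAt E.x
    (matA *ᵥ E.x t + matB *ᵥ (D.g • e3 + E.R t *ᵥ V.aB t) + D.K *ᵥ outErr D V E t
      + σx D V E t) J t

/-- The attitude error `R̃ = R R̂ᵀ`. -/
def Rtil (t : ℝ) : M3 := V.R t * (E.R t)ᵀ

/-- The bias error `b̃_ω = b_ω - b̂_ω`. -/
def btil (t : ℝ) : V3 := V.bω - E.b t

/-- The translational error `x̃ = x - x̂`. -/
def xtil (t : ℝ) : I6 → ℝ := V.x t - E.x t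

/-- The auxiliary error `ζ = L_γ⁻¹ [(A - K C) x̃ + B (I - R̃)ᵀ a_I]`. -/
def zeta (t : ℝ) : I6 → ℝ :=
  (matL D.γ)⁻¹ *ᵥ
    ((matA - D.K * matC D.Cp) *ᵥ xtil V E t + matB *ᵥ ((1 - Rtil V E t)ᵀ *ᵥ V.aI t))

/-- The size of the estimation errors `(ζ, R̃, b̃_ω)`. -/
def err (t : ℝ) : ℝ :=
  euc (zeta D V E t) + attNorm (Rtil V E t) + euc (btil V E t)

end ClosedLoop

/-- The time interval `[0, T)`, where `T = ⊤` gives `[0, ∞)`. -/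
def timeIco (T : EReal) : Set ℝ := {t | 0 ≤ t ∧ (t : EReal) < T}

end

end NavObs

open NavObs

namespace NavObs

/-! ### Euclidean norm -/

section Euclidean

variable {ι κ : Type} [Fintype ι] [Fintype κ]

/-! In inertial coordinates the errors are the rotation `Q = R R̂ᵀ`, the bias error `z = R̂ b̃` and
`ξ = γ² ζ`. Two features of the observer make them tractable. The injection `K_v (y - C x̂)` equals
`(I - Q)ᵀ a_I` minus the velocity block of `ξ` (`Kv_outErr_eq`), so it stands in for the unmeasured
`a_I`. And `σ_p`, `σ_v` cancel the `k_R` terms in the derivative of `ξ`, leaving `ξ' = γ A₀ ξ +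
O(|Q| + ‖z‖)` with `A₀ = A - K₀ C` Hurwitz (`exists_errorFlow`).

The lower bound available for the attitude innovation degenerates at half-turns, so `|Q|` must first
be kept away from 1. Initially `‖ξ‖` may be of size `γ² r`, but it enters the innovation through a
saturation: its effect is `O(√γ exp(-αγt/4))`, whose time integral is `O(1/√γ)`, plus an `O(1/γ)`
remainder. A large `k_R` beats the bounded bias error wherever `ε ≤ |Q| ≤ (1+ε)/2`, and a barrier
argument then keeps `|Q|` below `(1+ε)/2` (`exists_gain_attNorm_le`).

In that region a strict Lyapunov function is `pot + ‖z‖²/(2k_b) + μ s·z + ξᵀPξ`, where `s` is the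
axial vector of `Q` (`exists_gain_exp_decay`). The adaptation law cancels the term of `pot'` that
couples `z` to the unperturbed innovation, the cross term supplies `-μ‖z‖²`, and a large `γ` absorbs
every coupling with `ξ`. No constant depends on the length of the time interval, so `T` is
arbitrary. -/

theorem euc_nonneg (x : ι → ℝ) : 0 ≤ euc x := norm_nonneg _

theorem euc_sq (x : ι → ℝ) : euc x ^ 2 = x ⬝ᵥ x := by
  unfold euc
  rw [EuclideanSpace.real_norm_sq_eq]
  simp [dotProduct, sq]

theorem euc_smul (c : ℝ) (x : ι → ℝ) : euc (c • x) = |c| * euc x := by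
  simp [euc, norm_smul]

theorem euc_neg (x : ι → ℝ) : euc (-x) = euc x := by simp [euc]

theorem euc_add_le (x y : ι → ℝ) : euc (x + y) ≤ euc x + euc y := by
  simpa [euc] using norm_add_le (WithLp.toLp 2 x : EuclideanSpace ℝ ι) (WithLp.toLp 2 y)

theorem euc_sub_le (x y : ι → ℝ) : euc (x - y) ≤ euc x + euc y := by
  simpa [euc] using norm_sub_le (WithLp.toLp 2 x : EuclideanSpace ℝ ι) (WithLp.toLp 2 y)

theorem abs_dot_le (x y : ι → ℝ) : |x ⬝ᵥ y| ≤ euc x * euc y := by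
  have := abs_real_inner_le_norm (WithLp.toLp 2 x : EuclideanSpace ℝ ι) (WithLp.toLp 2 y)
  rwa [EuclideanSpace.inner_toLp_toLp, dotProduct_comm] at this

theorem dot_le (x y : ι → ℝ) : x ⬝ᵥ y ≤ euc x * euc y := (le_abs_self _).trans (abs_dot_le x y)

theorem neg_le_dot (x y : ι → ℝ) : -(euc x * euc y) ≤ x ⬝ᵥ y :=
  neg_le_of_abs_le (abs_dot_le x y)

theorem euc_le_of_sq_le {x : ι → ℝ} {c : ℝ} (hc : 0 ≤ c) (h : x ⬝ᵥ x ≤ c ^ 2) : euc x ≤ c :=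
  le_of_sq_le_sq (by rwa [euc_sq]) hc

theorem euc_cross_le (x y : V3) : euc (crossProduct x y) ≤ euc x * euc y := by
  refine euc_le_of_sq_le (mul_nonneg (euc_nonneg _) (euc_nonneg _)) ?_
  rw [mul_pow, euc_sq, euc_sq, cross_dot_cross, dotProduct_comm y x]
  nlinarith [sq_nonneg (x ⬝ᵥ y)]

/-- Cauchy–Schwarz row by row; the constant is the squared Frobenius norm. -/
theorem euc_mulVec_sq_le (M : Matrix ι κ ℝ) (x : κ → ℝ) :
    euc (M *ᵥ x) ^ 2 ≤ (∑ i, M i ⬝ᵥ M i) * euc x ^ 2 := by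
  rw [euc_sq, Finset.sum_mul, dotProduct]
  refine Finset.sum_le_sum fun i _ => ?_
  have := abs_dot_le (M i) x
  rw [← euc_sq, ← mul_pow, ← sq]
  exact sq_le_sq' (neg_le_of_abs_le this) (le_of_abs_le this)

theorem exists_euc_mulVec_le (M : Matrix ι κ ℝ) :
    ∃ c : ℝ, 0 ≤ c ∧ ∀ x, euc (M *ᵥ x) ≤ c * euc x := by
  have hs : 0 ≤ ∑ i, M i ⬝ᵥ M i :=
    Finset.sum_nonneg fun i _ => by rw [← euc_sq]; positivity
  refine ⟨Real.sqrt (∑ i, M i ⬝ᵥ M i), Real.sqrt_nonneg _, fun x => ?_⟩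
  refine le_of_sq_le_sq ?_ (mul_nonneg (Real.sqrt_nonneg _) (euc_nonneg _))
  rw [mul_pow, Real.sq_sqrt hs]
  exact euc_mulVec_sq_le M x

theorem dot_transpose_mul_mulVec (N P : Matrix ι ι ℝ) (x : ι → ℝ) :
    x ⬝ᵥ (Nᵀ * P * N) *ᵥ x = (N *ᵥ x) ⬝ᵥ P *ᵥ (N *ᵥ x) := by
  rw [← mulVec_mulVec, ← mulVec_mulVec, dotProduct_mulVec, vecMul_transpose]

end Euclidean

/-! ### Derivatives of products -/

section Derivatives

variable {ι κ l : Type} [Fintype κ] [Fintype l] {s : Set ℝ} {t : ℝ}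

/-- A matrix is definitionally a family of rows, so the criterion for products applies twice. It
reduces all matrix calculus below to scalar product rules. -/
theorem hasDerivWithinAt_matrix {f : ℝ → Matrix ι κ ℝ} {f' : Matrix ι κ ℝ} :
    HasDerivWithinAt f f' s t ↔ ∀ i j, HasDerivWithinAt (fun t => f t i j) (f' i j) s t := by
  have := hasDerivWithinAt_pi (𝕜 := ℝ) (x := t) (s := s) (E' := fun _ : ι => κ → ℝ)
    (φ := f) (φ' := f')
  rw [show HasDerivWithinAt f f' s t ↔ _ from this]
  simp only [hasDerivWithinAt_pi]

theorem hasDerivWithinAt_matrix_mono {f : ℝ → Matrix ι κ ℝ} {f' : Matrix ι κ ℝ} {r : Set ℝ}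
    [Fintype ι] (h : HasDerivWithinAt f f' s t) (hr : r ⊆ s) : HasDerivWithinAt f f' r t :=
  hasDerivWithinAt_matrix.2 fun i j => (hasDerivWithinAt_matrix.1 h i j).mono hr

theorem hasDerivWithinAt_dot {u v : ℝ → κ → ℝ} {u' v' : κ → ℝ}
    (hu : HasDerivWithinAt u u' s t) (hv : HasDerivWithinAt v v' s t) :
    HasDerivWithinAt (fun t => u t ⬝ᵥ v t) (u' ⬝ᵥ v t + u t ⬝ᵥ v') s t := by
  simp only [dotProduct]
  rw [← Finset.sum_add_distrib]
  rw [hasDerivWithinAt_pi] at hu hv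
  exact HasDerivWithinAt.fun_sum fun i _ => (hu i).mul (hv i)

theorem hasDerivWithinAt_mul {A : ℝ → Matrix ι κ ℝ} {B : ℝ → Matrix κ l ℝ} {A' : Matrix ι κ ℝ}
    {B' : Matrix κ l ℝ}
    (hA : HasDerivWithinAt A A' s t) (hB : HasDerivWithinAt B B' s t) :
    HasDerivWithinAt (fun t => A t * B t) (A' * B t + A t * B') s t := by
  rw [hasDerivWithinAt_matrix] at *
  intro i j
  simp only [Matrix.add_apply, mul_apply]
  rw [← Finset.sum_add_distrib]
  exact HasDerivWithinAt.fun_sum fun k _ => (hA i k).mul (hB k j)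

theorem hasDerivWithinAt_transpose [Fintype ι] {A : ℝ → Matrix ι κ ℝ} {A' : Matrix ι κ ℝ}
    (hA : HasDerivWithinAt A A' s t) : HasDerivWithinAt (fun t => (A t)ᵀ) A'ᵀ s t := by
  rw [hasDerivWithinAt_matrix] at *
  exact fun i j => hA j i

theorem hasDerivWithinAt_mulVec [Fintype ι] {A : ℝ → Matrix ι κ ℝ} {u : ℝ → κ → ℝ} {A' : Matrix ι κ ℝ}
    {u' : κ → ℝ} (hA : HasDerivWithinAt A A' s t) (hu : HasDerivWithinAt u u' s t) :
    HasDerivWithinAt (fun t => A t *ᵥ u t) (A' *ᵥ u t + A t *ᵥ u') s t := by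
  rw [hasDerivWithinAt_matrix] at hA
  rw [hasDerivWithinAt_pi] at *
  exact fun i => hasDerivWithinAt_dot (hasDerivWithinAt_pi.2 (hA i)) (hasDerivWithinAt_pi.2 hu)

theorem hasDerivWithinAt_const_mulVec [Fintype ι] (A : Matrix ι κ ℝ) {u : ℝ → κ → ℝ}
    {u' : κ → ℝ} (hu : HasDerivWithinAt u u' s t) :
    HasDerivWithinAt (fun t => A *ᵥ u t) (A *ᵥ u') s t := by
  have h : HasDerivWithinAt (fun _ => A) 0 s t :=
    hasDerivWithinAt_matrix.2 fun _ _ => hasDerivWithinAt_const _ _ _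
  simpa using hasDerivWithinAt_mulVec h hu

theorem hasDerivWithinAt_trace {A : ℝ → Matrix κ κ ℝ} {A' : Matrix κ κ ℝ}
    (hA : HasDerivWithinAt A A' s t) :
    HasDerivWithinAt (fun t => (A t).trace) A'.trace s t := by
  rw [hasDerivWithinAt_matrix] at hA
  exact HasDerivWithinAt.fun_sum fun i _ => hA i i

end Derivatives

/-! ### Quadratic Lyapunov functions of Hurwitz matrices -/

section Lyapunov

open Filter Topology

/-- By Gelfand's formula, `‖a ^ n‖ ≤ q ^ n` eventually, for any `q` strictly between the spectral
radius and 1. -/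
theorem tendsto_pow_zero_of_spectralRadius_lt_one {A : Type*} [NormedRing A] [NormedAlgebra ℂ A]
    [CompleteSpace A] {a : A} (h : spectralRadius ℂ a < 1) :
    Tendsto (fun n : ℕ => a ^ n) atTop (𝓝 0) := by
  obtain ⟨q, hq, hq1⟩ := exists_between h
  have h1 := spectrum.pow_nnnorm_pow_one_div_tendsto_nhds_spectralRadius a
  have h2 := h1.eventually_lt_const hq
  have hqt : q ≠ ⊤ := (hq1.trans ENNReal.one_lt_top).ne
  lift q to NNReal using hqt
  rw [tendsto_zero_iff_norm_tendsto_zero]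
  have hq1' : (q : ℝ) < 1 := by exact_mod_cast hq1
  refine squeeze_zero' (Eventually.of_forall fun n => norm_nonneg _) ?_
    (tendsto_pow_atTop_nhds_zero_of_lt_one q.2 hq1')
  filter_upwards [h2, eventually_gt_atTop 0] with n hn hn0
  have hn' : (0 : ℝ) < n := by exact_mod_cast hn0
  have := ENNReal.rpow_le_rpow hn.le hn'.le
  rw [← ENNReal.rpow_mul, one_div, inv_mul_cancel₀ hn'.ne', ENNReal.rpow_one,
    ENNReal.rpow_natCast] at this
  exact_mod_cast this

variable {ι : Type} [Fintype ι] [DecidableEq ι]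

/-- A small forward Euler step of a Hurwitz system is a contraction in the long run. -/
theorem IsHurwitz.exists_pow_tendsto {M : Matrix ι ι ℝ} (hM : IsHurwitz M) :
    ∃ h : ℝ, 0 < h ∧ Tendsto (fun n : ℕ => (1 + h • M) ^ n) atTop (𝓝 0) := by
  cases isEmpty_or_nonempty ι
  · refine ⟨1, one_pos, ?_⟩
    rw [show (fun n : ℕ => (1 + (1 : ℝ) • M) ^ n) = fun _ => 0 from
      funext fun _ => Subsingleton.elim _ _]
    exact tendsto_const_nhds
  let _ : NormedRing (Matrix ι ι ℂ) := Matrix.linftyOpNormedRing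
  let _ : NormedAlgebra ℂ (Matrix ι ι ℂ) := Matrix.linftyOpNormedAlgebra
  set N : Matrix ι ι ℂ := M.map (algebraMap ℝ ℂ) with hN
  have hfin : (spectrum ℂ N).Finite := Module.End.finite_spectrum (Matrix.toLin' N) |>.subset
    (by rw [Matrix.spectrum_toLin'])
  -- each eigenvalue is moved into the unit disc by all small steps
  have hz : ∀ z ∈ spectrum ℂ N, ∀ᶠ h : ℝ in 𝓝[>] 0, ‖1 + (h : ℂ) * z‖ < 1 := by
    intro z hz
    have hre := hM z hz
    -- `|1 + hz|² = 1 + 2h Re z + h²|z|²` is below 1 once `h|z|² < -2 Re z`; the `+ 1` keeps the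
    -- denominator nonzero.
    have hpos : 0 < -2 * z.re / (Complex.normSq z + 1) :=
      div_pos (by linarith) (by have := Complex.normSq_nonneg z; linarith)
    filter_upwards [Ioo_mem_nhdsGT hpos] with h hh
    rw [← sq_lt_one_iff₀ (norm_nonneg _), ← Complex.normSq_eq_norm_sq]
    have h1 : h * (Complex.normSq z + 1) < -2 * z.re :=
      (lt_div_iff₀ (by have := Complex.normSq_nonneg z; linarith)).1 hh.2
    have h0 := hh.1
    simp only [Complex.normSq_apply, Complex.add_re, Complex.one_re, Complex.mul_re,
      Complex.ofReal_re, Complex.ofReal_im, Complex.add_im, Complex.one_im, Complex.mul_im] at *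
    nlinarith
  obtain ⟨h, hh, hpos⟩ := (((eventually_all_finite hfin).2 hz).and self_mem_nhdsWithin).exists
  refine ⟨h, hpos, ?_⟩
  have hsp : spectralRadius ℂ (1 + (h : ℂ) • N) < 1 := by
    have hne : (1 + (h : ℂ) • N) = algebraMap ℂ (Matrix ι ι ℂ) 1 + (h : ℂ) • N := by simp
    refine spectrum.spectralRadius_lt_of_forall_lt (r := 1) _ fun k hk => ?_
    rw [hne, ← spectrum.singleton_add_eq, spectrum.smul_eq_smul _ _ (spectrum.nonempty N)] at hk
    obtain ⟨_, rfl, w, ⟨z, hz, rfl⟩, rfl⟩ := hk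
    have := hh z hz
    rw [← NNReal.coe_lt_coe]
    simpa using this
  have ht := tendsto_pow_zero_of_spectralRadius_lt_one hsp
  have hmap : ∀ n : ℕ, (1 + (h : ℂ) • N) ^ n = ((1 + h • M) ^ n).map (algebraMap ℝ ℂ) := by
    intro n
    rw [← RingHom.mapMatrix_apply, map_pow]
    congr 1
    ext i j
    simp [hN, Matrix.one_apply, apply_ite]
  have ht' : Tendsto (fun n : ℕ => ((1 + h • M) ^ n).map (algebraMap ℝ ℂ)) atTop (𝓝 0) := by
    simp only [hmap] at ht
    exact ht
  refine tendsto_pi_nhds.2 fun i => tendsto_pi_nhds.2 fun j => ?_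
  have h1 := (tendsto_pi_nhds.1 ((tendsto_pi_nhds.1 ht') i)) j
  have h2 := (Complex.continuous_re.tendsto _).comp h1
  simpa [Function.comp_def] using h2

/-- A discrete Lyapunov sum replaces the usual integral of matrix exponentials. With `N = 1 + hM`
and `P = ∑_{k<n} (Nᵏ)ᵀ Nᵏ`, telescoping gives `NᵀPN - P = (Nⁿ)ᵀNⁿ - 1 ≤ -1/2` for suitable `n`.
Expanding `N` leaves `2h xᵀPMx` plus a nonnegative square, which may be dropped. The term `k = 0`
gives `P ≥ 1`. -/
theorem IsHurwitz.exists_lyapunov {M : Matrix ι ι ℝ} (hM : IsHurwitz M) :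
    ∃ (P : Matrix ι ι ℝ) (a p : ℝ), 0 < a ∧ 1 ≤ p ∧ Pᵀ = P ∧ (∀ x, euc x ^ 2 ≤ x ⬝ᵥ P *ᵥ x) ∧
      (∀ x, x ⬝ᵥ P *ᵥ x ≤ p * euc x ^ 2) ∧ ∀ x, x ⬝ᵥ P *ᵥ (M *ᵥ x) ≤ -a * euc x ^ 2 := by
  obtain ⟨h, hpos, hlim⟩ := hM.exists_pow_tendsto
  set N := 1 + h • M with hN
  obtain ⟨n, hn0, hn⟩ : ∃ n : ℕ, 0 < n ∧ ∀ x, euc (N ^ n *ᵥ x) ^ 2 ≤ 1 / 2 * euc x ^ 2 := by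
    have hl : Tendsto (fun n : ℕ => ∑ i, (N ^ n) i ⬝ᵥ (N ^ n) i) atTop (𝓝 0) := by
      rw [show (0 : ℝ) = ∑ i : ι, (0 : ι → ℝ) ⬝ᵥ 0 by simp]
      refine tendsto_finsetSum _ fun i _ => ?_
      have := tendsto_pi_nhds.1 hlim i
      exact ((continuous_id.dotProduct continuous_id).tendsto _).comp this
    obtain ⟨n, hn, hn0⟩ := ((hl.eventually_lt_const (by norm_num : (0 : ℝ) < 1 / 2)).and
      (eventually_gt_atTop 0)).exists
    refine ⟨n, hn0, fun x => ?_⟩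
    exact (euc_mulVec_sq_le _ x).trans (mul_le_mul_of_nonneg_right hn.le (sq_nonneg _))
  set P : Matrix ι ι ℝ := ∑ k ∈ Finset.range n, (N ^ k)ᵀ * N ^ k with hP
  have hPx : ∀ x, x ⬝ᵥ P *ᵥ x = ∑ k ∈ Finset.range n, euc (N ^ k *ᵥ x) ^ 2 := by
    intro x
    rw [hP, sum_mulVec, dotProduct_sum]
    refine Finset.sum_congr rfl fun k _ => ?_
    have := dot_transpose_mul_mulVec (N ^ k) 1 x
    simpa [euc_sq] using this
  have hlow : ∀ x, euc x ^ 2 ≤ x ⬝ᵥ P *ᵥ x := by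
    intro x
    rw [hPx]
    have := Finset.single_le_sum (f := fun k => euc (N ^ k *ᵥ x) ^ 2)
      (fun k _ => sq_nonneg _) (Finset.mem_range.2 hn0)
    simpa using this
  have hPt : Pᵀ = P := by
    rw [hP, transpose_sum]
    simp
  obtain ⟨p, hp0, hp⟩ := exists_euc_mulVec_le P
  -- The rate is `1/2` divided by `2h`; `p + 1` secures the normalization `1 ≤ p`.
  refine ⟨P, 1 / (4 * h), p + 1, by positivity, by linarith, hPt, hlow, fun x => ?_, fun x => ?_⟩
  · have h1 := dot_le x (P *ᵥ x)
    have h2 := mul_le_mul_of_nonneg_left (hp x) (euc_nonneg x)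
    nlinarith [sq_nonneg (euc x)]
  · have hstep : (N *ᵥ x) ⬝ᵥ P *ᵥ (N *ᵥ x) - x ⬝ᵥ P *ᵥ x = euc (N ^ n *ᵥ x) ^ 2 - euc x ^ 2 := by
      rw [hPx, hPx, ← Finset.sum_sub_distrib]
      have := Finset.sum_range_sub (fun k => euc (N ^ k *ᵥ x) ^ 2) n
      simp only [pow_zero, one_mulVec] at this
      rw [← this]
      refine Finset.sum_congr rfl fun k _ => ?_
      rw [mulVec_mulVec, ← pow_succ]
    have hsym : (M *ᵥ x) ⬝ᵥ P *ᵥ x = x ⬝ᵥ P *ᵥ (M *ᵥ x) := by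
      rw [dotProduct_mulVec, dotProduct_comm, ← mulVec_transpose, hPt]
    have hexp : (N *ᵥ x) ⬝ᵥ P *ᵥ (N *ᵥ x) = x ⬝ᵥ P *ᵥ x + 2 * h * (x ⬝ᵥ P *ᵥ (M *ᵥ x))
        + h ^ 2 * ((M *ᵥ x) ⬝ᵥ P *ᵥ (M *ᵥ x)) := by
      rw [hN, add_mulVec, one_mulVec, smul_mulVec]
      simp only [mulVec_add, mulVec_smul, dotProduct_add, add_dotProduct, dotProduct_smul,
        smul_dotProduct, hsym, smul_eq_mul]
      ring
    have hq := hlow (M *ᵥ x)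
    have h3 := hn x
    have h4 : 0 ≤ h ^ 2 * ((M *ᵥ x) ⬝ᵥ P *ᵥ (M *ᵥ x)) :=
      mul_nonneg (sq_nonneg _) ((sq_nonneg _).trans hq)
    have h5 : 2 * h * (x ⬝ᵥ P *ᵥ (M *ᵥ x)) ≤ -(1 / 2) * euc x ^ 2 := by linarith
    have h6 : -(1 / (4 * h)) * euc x ^ 2 = (-(1 / 2) * euc x ^ 2) / (2 * h) := by
      field_simp
      ring
    rw [h6, le_div_iff₀ (by positivity)]
    linarith

end Lyapunov

/-! ### Rotations -/

/-- The axial vector of the skew-symmetric part of a matrix. -/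
noncomputable def axial (M : M3) : V3 := ![(M 2 1 - M 1 2) / 2, (M 0 2 - M 2 0) / 2, (M 1 0 - M 0 1) / 2]

theorem skew_transpose (x : V3) : (skew x)ᵀ = -skew x := by
  ext i j
  fin_cases i <;> fin_cases j <;> simp [skew]

theorem skew_axial (M : M3) : (2 : ℝ) • skew (axial M) = M - Mᵀ := by
  ext i j
  fin_cases i <;> fin_cases j <;> simp [skew, axial] <;> ring

theorem axial_skew (x : V3) : axial (skew x) = x := by
  ext i
  fin_cases i <;> simp [skew, axial]

theorem two_smul_axial_cross (M : M3) (x : V3) :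
    (2 : ℝ) • crossProduct (axial M) x = M *ᵥ x - Mᵀ *ᵥ x := by
  rw [← skew_mulVec, ← smul_mulVec, skew_axial, sub_mulVec]

theorem trace_mul_skew (M : M3) (w : V3) : (M * skew w).trace = -2 * (axial M ⬝ᵥ w) := by
  simp [trace, Fin.sum_univ_three, mul_apply, skew, axial, dotProduct]
  ring

/-- Supplies the derivative of the axial vector along `Q' = -Q [w]_×`. -/
theorem axial_mul_skew (M : M3) (w : V3) :
    axial (M * skew w) = (1 / 2 : ℝ) • (M.trace • w - Mᵀ *ᵥ w) := by
  ext i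
  fin_cases i <;>
  · simp [trace, Fin.sum_univ_three, mul_apply, skew, axial, dotProduct, mulVec]
    ring

/-- A polynomial identity for all matrices; for a rotation the adjugate is the transpose, so that
rotations commute with the cross product. -/
theorem adjugate_transpose_mulVec_cross (M : M3) (x y : V3) :
    (adjugate M)ᵀ *ᵥ crossProduct x y = crossProduct (M *ᵥ x) (M *ᵥ y) := by
  ext i
  fin_cases i <;>
  · simp [adjugate_fin_three, mulVec, dotProduct, Fin.sum_univ_three, cross_apply]
    ring

theorem attNorm_transpose (M : M3) : attNorm Mᵀ = attNorm M := by
  rw [attNorm, attNorm, trace_sub, trace_sub, trace_transpose]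

section SO3

variable {Q : M3} (hQ : Q ∈ specialOrthogonalGroup (Fin 3) ℝ)
include hQ

theorem mul_transpose_of_mem : Q * Qᵀ = 1 :=
  (mem_orthogonalGroup_iff (Fin 3) ℝ).1 (mem_specialOrthogonalGroup_iff.1 hQ).1

theorem transpose_mul_of_mem : Qᵀ * Q = 1 :=
  (mem_orthogonalGroup_iff' (Fin 3) ℝ).1 (mem_specialOrthogonalGroup_iff.1 hQ).1

theorem transpose_mem : Qᵀ ∈ specialOrthogonalGroup (Fin 3) ℝ := by
  rw [mem_specialOrthogonalGroup_iff, mem_orthogonalGroup_iff, det_transpose]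
  exact ⟨transpose_mul_of_mem hQ, (mem_specialOrthogonalGroup_iff.1 hQ).2⟩

theorem adjugate_of_mem : adjugate Q = Qᵀ := by
  have h := congrArg (· * Qᵀ) (adjugate_mul Q)
  simpa [Matrix.mul_assoc, mul_transpose_of_mem hQ, (mem_specialOrthogonalGroup_iff.1 hQ).2]
    using h

theorem rot_cross (x y : V3) : Q *ᵥ crossProduct x y = crossProduct (Q *ᵥ x) (Q *ᵥ y) := by
  rw [← adjugate_transpose_mulVec_cross, adjugate_of_mem hQ, transpose_transpose]

theorem rot_dot (x y : V3) : (Q *ᵥ x) ⬝ᵥ (Q *ᵥ y) = x ⬝ᵥ y := by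
  rw [dotProduct_mulVec, vecMul_mulVec, transpose_mul_of_mem hQ, vecMul_one]

theorem rot_transpose_rot (x : V3) : Qᵀ *ᵥ (Q *ᵥ x) = x := by
  rw [mulVec_mulVec, transpose_mul_of_mem hQ, one_mulVec]

theorem rot_rot_transpose (x : V3) : Q *ᵥ (Qᵀ *ᵥ x) = x := by
  rw [mulVec_mulVec, mul_transpose_of_mem hQ, one_mulVec]

theorem euc_rot (x : V3) : euc (Q *ᵥ x) = euc x := by
  refine (sq_eq_sq₀ (euc_nonneg _) (euc_nonneg _)).1 ?_
  rw [euc_sq, euc_sq, rot_dot hQ]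

theorem rot_mul_skew_mul (x : V3) : Q * skew x * Qᵀ = skew (Q *ᵥ x) := by
  refine ext_of_mulVec_single fun i => ?_
  rw [skew_mulVec, ← mulVec_mulVec, ← mulVec_mulVec, skew_mulVec, rot_cross hQ,
    rot_rot_transpose hQ]

/-- The axial vector lies on the rotation axis: conjugation by `Q` fixes `Q - Qᵀ`. -/
theorem rot_mulVec_axial : Q *ᵥ axial Q = axial Q := by
  have h : skew (Q *ᵥ axial Q) = skew (axial Q) := by
    have h2 : (2 : ℝ) • skew (Q *ᵥ axial Q) = (2 : ℝ) • skew (axial Q) := by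
      rw [← rot_mul_skew_mul hQ, ← Matrix.smul_mul, ← Matrix.mul_smul, skew_axial, Matrix.mul_sub,
        Matrix.sub_mul, mul_transpose_of_mem hQ, Matrix.mul_assoc, mul_transpose_of_mem hQ]
      simp
    exact smul_right_injective _ (two_ne_zero : (2 : ℝ) ≠ 0) h2
  rw [← axial_skew (Q *ᵥ axial Q), h, axial_skew]

/-- Why the innovation is corrective. Since `2 s × a = Qa - Qᵀa`, the square `2‖s × a‖²` splits into
two triple products, and these agree because `Q` fixes `s`. -/
theorem axial_dot_rot_cross (a : V3) :
    axial Q ⬝ᵥ crossProduct (Qᵀ *ᵥ a) a = euc (crossProduct (axial Q) a) ^ 2 := by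
  have h1 : axial Q ⬝ᵥ crossProduct (Qᵀ *ᵥ a) a = axial Q ⬝ᵥ crossProduct a (Q *ᵥ a) := by
    rw [← rot_dot hQ, rot_mulVec_axial hQ, rot_cross hQ, rot_rot_transpose hQ]
  have h2 : 2 * euc (crossProduct (axial Q) a) ^ 2 =
      crossProduct (axial Q) a ⬝ᵥ (Q *ᵥ a - Qᵀ *ᵥ a) := by
    rw [← two_smul_axial_cross, dotProduct_smul, euc_sq, smul_eq_mul]
  have h3 : ∀ x y z : V3, crossProduct x y ⬝ᵥ z = x ⬝ᵥ crossProduct y z := by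
    intro x y z
    rw [dotProduct_comm, triple_product_permutation]
  have h4 : crossProduct a (Qᵀ *ᵥ a) = -crossProduct (Qᵀ *ᵥ a) a := (cross_anticomm _ _).symm
  rw [dotProduct_sub, h3, h3, h4, dotProduct_neg, ← h1] at h2
  linarith

theorem trace_mul_self_of_mem : (Q * Q).trace = Q.trace ^ 2 - 2 * Q.trace := by
  have h : Q.trace = (adjugate Q).trace := by rw [adjugate_of_mem hQ, trace_transpose]
  have h2 : (Q * Q).trace = Q.trace ^ 2 - 2 * (adjugate Q).trace := by
    simp [trace, Fin.sum_univ_three, mul_apply, adjugate_fin_three]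
    ring
  rw [h2, ← h]

theorem sum_dot_rows : ∑ i, Q i ⬝ᵥ Q i = 3 := by
  have h := congrArg trace (mul_transpose_of_mem hQ)
  simpa [trace, mul_apply, dotProduct] using h

theorem trace_le_three : Q.trace ≤ 3 := by
  have h : ∑ i, (1 - Q) i ⬝ᵥ (1 - Q) i = ∑ i, Q i ⬝ᵥ Q i + 3 - 2 * Q.trace := by
    simp [trace, Fin.sum_univ_three, dotProduct, Matrix.one_apply]
    ring
  have h2 : 0 ≤ ∑ i, (1 - Q) i ⬝ᵥ (1 - Q) i :=
    Finset.sum_nonneg fun i _ => by rw [← euc_sq]; positivity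
  rw [h, sum_dot_rows hQ] at h2
  linarith

theorem attNorm_sq : attNorm Q ^ 2 = (3 - Q.trace) / 4 := by
  rw [attNorm, trace_sub, Real.sq_sqrt]
  · simp
  · have := trace_le_three hQ
    simp
    linarith

/-- For rotation angle `θ` this is `sin² θ = 4 sin²(θ/2) cos²(θ/2)`, with `|Q| = |sin(θ/2)|`. The
axial vector thus vanishes at half-turns as well as at the identity. -/
theorem euc_axial_sq : euc (axial Q) ^ 2 = 4 * attNorm Q ^ 2 * (1 - attNorm Q ^ 2) := by
  have h : 4 * euc (axial Q) ^ 2 = ∑ i, Q i ⬝ᵥ Q i - (Q * Q).trace := by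
    rw [euc_sq]
    simp [trace, Fin.sum_univ_three, mul_apply, axial, dotProduct]
    ring
  rw [sum_dot_rows hQ, trace_mul_self_of_mem hQ] at h
  rw [attNorm_sq hQ]
  linarith

theorem attNorm_le_one : attNorm Q ≤ 1 := by
  by_contra! h
  have h1 := euc_axial_sq hQ
  have h2 : 1 < attNorm Q ^ 2 := by nlinarith
  nlinarith [sq_nonneg (euc (axial Q))]

theorem euc_axial_le_one : euc (axial Q) ≤ 1 := by
  refine le_of_sq_le_sq ?_ zero_le_one
  rw [euc_axial_sq hQ]
  nlinarith [sq_nonneg (2 * attNorm Q ^ 2 - 1)]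

theorem euc_axial_le : euc (axial Q) ≤ 2 * attNorm Q := by
  refine le_of_sq_le_sq ?_ (mul_nonneg zero_le_two (Real.sqrt_nonneg _))
  rw [euc_axial_sq hQ]
  nlinarith [sq_nonneg (attNorm Q), sq_nonneg (attNorm Q ^ 2)]

/-- The factor is the Frobenius norm `‖I - Q‖_F = √8 |Q|`; this is the `√8` in the condition on
`ĉ₂`. -/
theorem euc_one_sub_mulVec_le (x : V3) :
    euc ((1 - Q) *ᵥ x) ≤ Real.sqrt 8 * attNorm Q * euc x := by
  have h0 : 0 ≤ attNorm Q := Real.sqrt_nonneg _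
  have h : ∑ i, (1 - Q) i ⬝ᵥ (1 - Q) i = ∑ i, Q i ⬝ᵥ Q i + 3 - 2 * Q.trace := by
    simp [trace, Fin.sum_univ_three, dotProduct, Matrix.one_apply]
    ring
  refine le_of_sq_le_sq ?_ (mul_nonneg (mul_nonneg (Real.sqrt_nonneg _) h0) (euc_nonneg _))
  rw [mul_pow, mul_pow, Real.sq_sqrt (by norm_num), attNorm_sq hQ]
  refine (euc_mulVec_sq_le _ _).trans_eq ?_
  rw [h, sum_dot_rows hQ]
  ring

theorem euc_one_sub_transpose_mulVec_le (x : V3) :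
    euc ((1 - Q)ᵀ *ᵥ x) ≤ Real.sqrt 8 * attNorm Q * euc x := by
  have h := euc_one_sub_mulVec_le (transpose_mem hQ) x
  rwa [attNorm_transpose, ← transpose_one, ← transpose_sub] at h

/-- `2 s × a` is the sum of `-(I - Q)a` and its image under `Qᵀ`, two vectors of equal length. -/
theorem euc_axial_cross_le (a : V3) : euc (crossProduct (axial Q) a) ≤ euc ((1 - Q) *ᵥ a) := by
  have h : (2 : ℝ) • crossProduct (axial Q) a = -((1 - Q) *ᵥ a) - Qᵀ *ᵥ ((1 - Q) *ᵥ a) := by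
    rw [two_smul_axial_cross]
    simp only [sub_mulVec, one_mulVec, mulVec_sub, rot_transpose_rot hQ]
    abel
  have h1 := congrArg euc h
  rw [euc_smul] at h1
  have h2 := euc_sub_le (-((1 - Q) *ᵥ a)) (Qᵀ *ᵥ ((1 - Q) *ᵥ a))
  rw [euc_neg, euc_rot (transpose_mem hQ)] at h2
  rw [abs_of_nonneg zero_le_two] at h1
  linarith

/-- The rotation-rate dependence of the axial vector is nearly the identity near `1`. -/
theorem euc_axial_mul_skew_sub_le (w : V3) :
    euc (axial (Q * skew w) - w) ≤ 4 * attNorm Q * euc w := by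
  have h0 : 0 ≤ attNorm Q := Real.sqrt_nonneg _
  have h1 := attNorm_le_one hQ
  have hw := euc_nonneg w
  have h : axial (Q * skew w) - w = (-2 * attNorm Q ^ 2) • w + (1 / 2 : ℝ) • ((1 - Q)ᵀ *ᵥ w) := by
    rw [axial_mul_skew, attNorm_sq hQ, transpose_sub, transpose_one, sub_mulVec, one_mulVec]
    module
  have h2 := euc_one_sub_transpose_mulVec_le hQ w
  have h3 : Real.sqrt 8 ≤ 4 := Real.sqrt_le_iff.2 ⟨by norm_num, by norm_num⟩
  have h4 : Real.sqrt 8 * (attNorm Q * euc w) ≤ 4 * (attNorm Q * euc w) :=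
    mul_le_mul_of_nonneg_right h3 (mul_nonneg h0 hw)
  have h5 : attNorm Q ^ 2 * euc w ≤ attNorm Q * euc w :=
    mul_le_mul_of_nonneg_right (by nlinarith) hw
  rw [h]
  refine (euc_add_le _ _).trans ?_
  rw [euc_smul, euc_smul, abs_of_nonpos (by nlinarith), abs_of_nonneg (by norm_num)]
  linarith

end SO3

/-- Two non-collinear directions determine the attitude error, quantitatively. -/
theorem euc_mul_euc_cross_le (s m a : V3) :
    euc s * euc (crossProduct m a) ≤
      2 * euc a * euc (crossProduct s m) + euc m * euc (crossProduct s a) := by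
  rcases eq_or_lt_of_le (euc_nonneg s) with hs | hs
  · rw [← hs, zero_mul]
    have := euc_nonneg a
    have := euc_nonneg m
    have := euc_nonneg (crossProduct s m)
    have := euc_nonneg (crossProduct s a)
    positivity
  -- This is `|s|² v = (s·v) s - s × (s × v)` for `v = m × a`, with the inner double product
  -- expanded.
  have h : (s ⬝ᵥ s) • crossProduct m a = (a ⬝ᵥ crossProduct s m) • s
      - ((s ⬝ᵥ a) • crossProduct s m - (s ⬝ᵥ m) • crossProduct s a) := by
    ext i
    fin_cases i <;>
    · simp [dotProduct, Fin.sum_univ_three, cross_apply]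
      ring
  have h1 := congrArg euc h
  rw [euc_smul, ← euc_sq, abs_of_nonneg (sq_nonneg _)] at h1
  have h2 := euc_sub_le ((a ⬝ᵥ crossProduct s m) • s)
    ((s ⬝ᵥ a) • crossProduct s m - (s ⬝ᵥ m) • crossProduct s a)
  have h3 := euc_sub_le ((s ⬝ᵥ a) • crossProduct s m) ((s ⬝ᵥ m) • crossProduct s a)
  rw [euc_smul] at h2
  rw [euc_smul, euc_smul] at h3
  have h4 := mul_le_mul_of_nonneg_right (abs_dot_le a (crossProduct s m)) hs.le
  have h5 := mul_le_mul_of_nonneg_right (abs_dot_le s a) (euc_nonneg (crossProduct s m))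
  have h6 := mul_le_mul_of_nonneg_right (abs_dot_le s m) (euc_nonneg (crossProduct s a))
  refine le_of_mul_le_mul_left ?_ hs
  nlinarith

/-! ### Saturation and projection -/

theorem euc_sat_le {c : ℝ} (hc : 0 ≤ c) (x : V3) : euc (sat c x) ≤ c := by
  rcases eq_or_lt_of_le (euc_nonneg x) with hx | hx
  · rw [sat, euc_smul, ← hx, mul_zero]
    exact hc
  · rw [sat, euc_smul, abs_of_nonneg (le_min zero_le_one (div_nonneg hc hx.le))]
    calc _ ≤ c / euc x * euc x := mul_le_mul_of_nonneg_right (min_le_right _ _) hx.le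
      _ = c := div_mul_cancel₀ _ hx.ne'

theorem euc_sat_sub_self_le {c : ℝ} (x : V3) :
    euc (sat c x - x) ≤ max 0 (euc x - c) := by
  rcases eq_or_lt_of_le (euc_nonneg x) with hx | hx
  · have h : sat c x - x = (min 1 (c / euc x) - 1) • x := by rw [sat]; module
    rw [h, euc_smul, ← hx, mul_zero]
    exact le_max_left _ _
  · have h : sat c x - x = (min 1 (c / euc x) - 1) • x := by rw [sat]; module
    rw [h, euc_smul, abs_of_nonpos (by linarith [min_le_left 1 (c / euc x)])]
    rcases le_total 1 (c / euc x) with h1 | h1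
    · rw [min_eq_left h1]
      simp
    · rw [min_eq_right h1]
      refine le_trans (le_of_eq ?_) (le_max_right _ _)
      field_simp
      ring

/-- The saturation changes a perturbation of an unsaturated vector by a bounded factor. -/
theorem euc_sat_sub_le {c : ℝ} (hc : 0 ≤ c) {u : V3} (hu : euc u ≤ c) (y : V3) :
    euc (sat c (u - y) - u) ≤ 2 * min c (euc y) := by
  rw [mul_min_of_nonneg _ _ zero_le_two]
  refine le_min ?_ ?_
  · linarith [euc_sub_le (sat c (u - y)) u, euc_sat_le hc (u - y)]
  -- Saturation moves `u - y` by its excess over `c`, which is at most `‖y‖` since `‖u‖ ≤ c`.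
  · have h1 := euc_add_le (sat c (u - y) - (u - y)) (-y)
    have h2 := euc_sat_sub_self_le (c := c) (u - y)
    have h3 : sat c (u - y) - u = sat c (u - y) - (u - y) + -y := by abel
    rw [h3]
    rw [euc_neg] at h1
    have h4 : max 0 (euc (u - y) - c) ≤ euc y :=
      max_le (euc_nonneg y) (by linarith [euc_sub_le u y])
    linarith

section Proj

variable {c ε : ℝ} (hc : 0 < c) (hε : 0 < ε) (φ μ : V3)
include hc hε

/-- A common form for both branches: a fraction `κ‖φ‖² ≤ 1` of the radial part of `μ` is removed,
and only when `φ` is outside the ball and `μ` points outward. -/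
theorem proj_eq : ∃ κ : ℝ, 0 ≤ κ ∧ κ * euc φ ^ 2 ≤ 1 ∧
    proj c ε φ μ = μ - (κ * (φ ⬝ᵥ μ)) • φ ∧ (κ = 0 ∨ c ≤ euc φ ∧ 0 < φ ⬝ᵥ μ) := by
  unfold proj
  split_ifs with h
  · exact ⟨0, le_rfl, by simp, by simp, Or.inl rfl⟩
  · push Not at h
    have hφ : 0 < euc φ := hc.trans_le h.1
    refine ⟨min 1 ((euc φ - c) / ε) / euc φ ^ 2, ?_, ?_, ?_, Or.inr h⟩
    · exact div_nonneg (le_min zero_le_one (div_nonneg (by linarith [h.1]) hε.le)) (sq_nonneg _)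
    · rw [div_mul_cancel₀ _ (by positivity)]
      exact min_le_left _ _
    · rw [sub_mulVec, one_mulVec, smul_mulVec, vecMulVec_mulVec, op_smul_eq_smul, smul_smul]

theorem euc_proj_le : euc (proj c ε φ μ) ≤ euc μ := by
  obtain ⟨κ, hk0, hk1, h, -⟩ := proj_eq hc hε φ μ
  rw [h]
  refine euc_le_of_sq_le (euc_nonneg _) ?_
  simp only [sub_dotProduct, dotProduct_sub, smul_dotProduct, dotProduct_smul, smul_eq_mul, euc_sq,
    dotProduct_comm μ φ]
  rw [← euc_sq φ, ← euc_sq μ]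
  have := mul_nonneg hk0 (sq_nonneg (φ ⬝ᵥ μ))
  nlinarith [mul_le_mul_of_nonneg_left hk1 this]

/-- The removed part is a nonnegative multiple of `φ`, and `(b - φ)·φ ≤ 0` when `‖b‖ ≤ c ≤ ‖φ‖`.
Hence the projection never spoils the decay of the bias error. -/
theorem dot_proj_ge {b : V3} (hb : euc b ≤ c) :
    (b - φ) ⬝ᵥ μ ≤ (b - φ) ⬝ᵥ proj c ε φ μ := by
  obtain ⟨κ, hk0, -, h, hκ⟩ := proj_eq hc hε φ μ
  rw [h]
  rcases hκ with rfl | ⟨h1, h2⟩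
  · simp
  have hφ : 0 < euc φ := hc.trans_le h1
  rw [dotProduct_sub, dotProduct_smul, smul_eq_mul, sub_dotProduct _ _ φ, ← euc_sq]
  have h4 := dot_le b φ
  have h5 : b ⬝ᵥ φ - euc φ ^ 2 ≤ 0 := by nlinarith
  have h6 : 0 ≤ κ * (φ ⬝ᵥ μ) := mul_nonneg hk0 h2.le
  nlinarith

/-- From radius `c + ε` on, the minimum equals 1 and the whole outward radial part is removed. -/
theorem dot_proj_nonpos (hφ : c + ε ≤ euc φ) : φ ⬝ᵥ proj c ε φ μ ≤ 0 := by
  unfold proj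
  have hpos : 0 < euc φ := by linarith
  split_ifs with h
  · rcases h with h | h
    · linarith
    · exact h
  · rw [min_eq_left ((one_le_div hε).2 (by linarith)), sub_mulVec, one_mulVec, smul_mulVec,
      vecMulVec_mulVec, op_smul_eq_smul, dotProduct_sub, dotProduct_smul, dotProduct_smul,
      ← euc_sq, smul_eq_mul, smul_eq_mul]
    refine le_of_eq ?_
    field_simp
    ring

end Proj

/-! ### Differential (in)equalities on compact intervals -/

section Calculus

open Set

theorem hasDerivWithinAt_Ici_of_Icc {F : Type*} [NormedAddCommGroup F] [NormedSpace ℝ F]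
    {f : ℝ → F} {f' : F} {b t : ℝ} (ht : t ∈ Ico 0 b)
    (h : HasDerivWithinAt f f' (Icc 0 b) t) : HasDerivWithinAt f f' (Ici t) t :=
  h.mono_of_mem_nhdsWithin (Icc_mem_nhdsGE_of_mem ht)

theorem eq_initial_of_deriv_zero {f : ℝ → ℝ} {b : ℝ}
    (h : ∀ t ∈ Icc 0 b, HasDerivWithinAt f 0 (Icc 0 b) t) : ∀ t ∈ Icc 0 b, f t = f 0 :=
  constant_of_has_deriv_right_zero (fun t ht => (h t ht).continuousWithinAt)
    fun t ht => hasDerivWithinAt_Ici_of_Icc ht (h t (Ico_subset_Icc_self ht))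

theorem le_initial_of_deriv_nonpos {f f' : ℝ → ℝ} {b : ℝ}
    (h : ∀ t ∈ Icc 0 b, HasDerivWithinAt f (f' t) (Icc 0 b) t) (h' : ∀ t ∈ Icc 0 b, f' t ≤ 0) :
    ∀ t ∈ Icc 0 b, f t ≤ f 0 :=
  image_le_of_deriv_right_le_deriv_boundary (fun t ht => (h t ht).continuousWithinAt)
    (fun t ht => hasDerivWithinAt_Ici_of_Icc ht (h t (Ico_subset_Icc_self ht))) le_rfl
    continuousOn_const (fun _ _ => hasDerivWithinAt_const _ _ _)
    fun t ht => h' t (Ico_subset_Icc_self ht)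

/-- A function that does not increase above a level stays below it. -/
theorem le_of_deriv_nonpos_above {f f' : ℝ → ℝ} {b c : ℝ}
    (h : ∀ t ∈ Icc 0 b, HasDerivWithinAt f (f' t) (Icc 0 b) t)
    (h' : ∀ t ∈ Icc 0 b, c ≤ f t → f' t ≤ 0) (h0 : f 0 ≤ c) : ∀ t ∈ Icc 0 b, f t ≤ c := by
  intro t ht
  by_contra! hlt
  have hcont : ContinuousOn f (Icc 0 b) := fun t ht => (h t ht).continuousWithinAt
  -- the last time before `t` at which the level is not exceeded
  set S := {s ∈ Icc 0 t | f s ≤ c} with hS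
  have hSne : S.Nonempty := ⟨0, ⟨le_rfl, ht.1⟩, h0⟩
  have hSb : BddAbove S := ⟨t, fun s hs => hs.1.2⟩
  have hSc : IsClosed S :=
    (hcont.mono (Icc_subset_Icc_right ht.2)).preimage_isClosed_of_isClosed isClosed_Icc isClosed_Iic
  have hs := hSc.csSup_mem hSne hSb
  set s := sSup S
  have hst : s < t := lt_of_le_of_ne hs.1.2 fun h => by
    have := hs.2
    rw [h] at this
    linarith
  have habove : ∀ x ∈ Ioc s t, c < f x := by
    intro x hx
    by_contra! hle
    exact absurd (le_csSup hSb ⟨⟨hs.1.1.trans hx.1.le, hx.2⟩, hle⟩) (not_le.2 hx.1)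
  have hsub : Icc s t ⊆ Icc 0 b := Icc_subset_Icc hs.1.1 ht.2
  have hanti : AntitoneOn f (Icc s t) := by
    refine antitoneOn_of_hasDerivWithinAt_nonpos (f' := f') (convex_Icc _ _) (hcont.mono hsub)
      (fun x hx => (h x (hsub (interior_subset hx))).mono (interior_subset.trans hsub))
      fun x hx => ?_
    rw [interior_Icc] at hx
    exact h' x (hsub (Ioo_subset_Icc_self hx)) (habove x ⟨hx.1, hx.2.le⟩).le
  have := hanti ⟨le_rfl, hst.le⟩ ⟨hst.le, le_rfl⟩ hst.le
  linarith [hs.2]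

/-- Grönwall: `exp(at) (f - d/a)` is nonincreasing. -/
theorem le_exp_mul_add_of_deriv_le {f f' : ℝ → ℝ} {a d b : ℝ} (ha : 0 < a)
    (h : ∀ t ∈ Icc 0 b, HasDerivWithinAt f (f' t) (Icc 0 b) t)
    (h' : ∀ t ∈ Icc 0 b, f' t ≤ -a * f t + d) (hd : 0 ≤ d) :
    ∀ t ∈ Icc 0 b, f t ≤ Real.exp (-a * t) * f 0 + d / a := by
  intro t ht
  have hexp : ∀ t, HasDerivAt (fun t => Real.exp (a * t)) (a * Real.exp (a * t)) t := by
    intro t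
    have := ((hasDerivAt_id t).const_mul a).exp
    simpa [mul_comm] using this
  have h1 := le_initial_of_deriv_nonpos
    (f := fun t => Real.exp (a * t) * (f t - d / a))
    (f' := fun t => a * Real.exp (a * t) * (f t - d / a) + Real.exp (a * t) * f' t) (b := b)
    (fun t ht => (hexp t).hasDerivWithinAt.mul ((h t ht).sub_const _))
    (fun t ht => by
      have e := Real.exp_pos (a * t)
      have h2 := mul_le_mul_of_nonneg_left (h' t ht) e.le
      have h3 : a * (d / a) = d := by field_simp
      have h4 : a * Real.exp (a * t) * (f t - d / a)
        = Real.exp (a * t) * (a * f t - d) := by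
        linear_combination -Real.exp (a * t) * h3
      rw [h4]
      nlinarith) t ht
  simp only [mul_zero, Real.exp_zero, one_mul] at h1
  have h5 := mul_le_mul_of_nonneg_left h1 (Real.exp_pos (-a * t)).le
  rw [← mul_assoc, ← Real.exp_add] at h5
  simp only [neg_mul, neg_add_cancel, Real.exp_zero, one_mul] at h5 ⊢
  have h6 : 0 ≤ Real.exp (-(a * t)) * (d / a) := by positivity
  linarith

/-- Skewness makes `F Fᵀ` constant; the determinant then has square 1 and, being continuous, keeps
its initial value 1. -/
theorem mem_SO3_of_deriv {F : ℝ → M3} {u : ℝ → V3} {b : ℝ}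
    (h0 : F 0 ∈ specialOrthogonalGroup (Fin 3) ℝ)
    (h : ∀ t ∈ Icc 0 b, HasDerivWithinAt F (F t * skew (u t)) (Icc 0 b) t) :
    ∀ t ∈ Icc 0 b, F t ∈ specialOrthogonalGroup (Fin 3) ℝ := by
  have hdG : ∀ t ∈ Icc 0 b, HasDerivWithinAt (fun t => F t * (F t)ᵀ) 0 (Icc 0 b) t := by
    intro t ht
    convert hasDerivWithinAt_mul (h t ht) (hasDerivWithinAt_transpose (h t ht)) using 1
    rw [transpose_mul, skew_transpose]
    simp [Matrix.mul_assoc]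
  have hG : ∀ t ∈ Icc 0 b, F t * (F t)ᵀ = 1 := by
    intro t ht
    rw [← mul_transpose_of_mem h0]
    ext i j
    exact eq_initial_of_deriv_zero (f := fun t => (F t * (F t)ᵀ) i j)
      (fun t ht => hasDerivWithinAt_matrix.1 (hdG t ht) i j) t ht
  have hcont : ContinuousOn (fun t => (F t).det) (Icc 0 b) := by
    intro t ht
    have hF : ContinuousWithinAt F (Icc 0 b) t :=
      tendsto_pi_nhds.2 fun i => tendsto_pi_nhds.2 fun j =>
        (hasDerivWithinAt_matrix.1 (h t ht) i j).continuousWithinAt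
    exact (continuous_id.matrix_det.continuousAt.comp_continuousWithinAt hF :)
  have hdet : EqOn (fun t => (F t).det) (fun _ => 1) (Icc 0 b) ∨ ¬(0 : ℝ) ∈ Icc 0 b := by
    by_cases hb : (0 : ℝ) ∈ Icc 0 b
    · refine Or.inl (isPreconnected_Icc.eq_of_sq_eq hcont continuousOn_const (fun t ht => ?_)
        (fun _ => one_ne_zero) hb (mem_specialOrthogonalGroup_iff.1 h0).2)
      have := congrArg det (hG t ht)
      rw [det_mul, det_transpose, det_one] at this
      simpa [sq] using this
    · exact Or.inr hb
  intro t ht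
  rw [mem_specialOrthogonalGroup_iff, mem_orthogonalGroup_iff]
  rcases hdet with hdet | hb
  · exact ⟨hG t ht, hdet ht⟩
  · exact absurd ⟨le_rfl, ht.1.trans ht.2⟩ hb

end Calculus

/-! ### The error dynamics -/

/-- The error matrix `A - K₀ C` in block form. -/
theorem matA_sub_eq {m : ℕ} (Cp : Matrix (Fin m) (Fin 3) ℝ) (K0 : Matrix I6 (Fin m) ℝ) :
    matA - K0 * matC Cp = fromBlocks (-(K0.toRows₁ * Cp)) 1 (-(K0.toRows₂ * Cp)) 0 := by
  have h : K0 * matC Cp = fromBlocks (K0.toRows₁ * Cp) 0 (K0.toRows₂ * Cp) 0 := by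
    conv_lhs => rw [← fromRows_toRows K0, matC, fromRows_mul_fromCols]
    simp
  rw [h, matA]
  ext (i | i) (j | j) <;> simp

/-- Trajectories on `[0, b]` of the attitude error `Q`, the inertial bias error `z` and the
scaled translational error `ξ = γ² ζ`, driven by the inertial apparent acceleration `a`;
`τ` is the inertial attitude innovation, `q` the inertial bias-error rate and `u` the inertial
angular velocity seen by the estimator. -/
structure ErrorFlow (A0 : Matrix I6 I6 ℝ) (mI : V3) (ρ1 ρ2 c2hat kb c0 c2 c3 c4 cb k γ b : ℝ) where
  Q : ℝ → M3
  a : ℝ → V3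
  ad : ℝ → V3
  z : ℝ → V3
  τ : ℝ → V3
  q : ℝ → V3
  u : ℝ → V3
  ξ : ℝ → I6 → ℝ
  Q_mem : ∀ t ∈ Set.Icc 0 b, Q t ∈ specialOrthogonalGroup (Fin 3) ℝ
  dQ : ∀ t ∈ Set.Icc 0 b, HasDerivWithinAt Q (-(Q t * skew (z t + k • τ t))) (Set.Icc 0 b) t
  da : ∀ t ∈ Set.Icc 0 b, HasDerivWithinAt a (ad t) (Set.Icc 0 b) t
  dz : ∀ t ∈ Set.Icc 0 b, HasDerivWithinAt z
    (crossProduct (u t + z t + k • τ t) (z t) + q t) (Set.Icc 0 b) t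
  dξ : ∀ t ∈ Set.Icc 0 b, HasDerivWithinAt ξ (γ • (A0 *ᵥ ξ t) +
    Sum.elim (0 : V3) ((1 - Q t)ᵀ *ᵥ ad t - crossProduct (z t) ((Q t)ᵀ *ᵥ a t))) (Set.Icc 0 b) t
  cross_a : ∀ t ∈ Set.Icc 0 b, c0 ≤ euc (crossProduct mI (a t))
  a_le : ∀ t ∈ Set.Icc 0 b, euc (a t) ≤ c2
  ad_le : ∀ t ∈ Set.Icc 0 b, euc (ad t) ≤ c3
  u_le : ∀ t ∈ Set.Icc 0 b, euc (u t) ≤ c4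
  z_le : ∀ t ∈ Set.Icc 0 b, euc (z t) ≤ cb
  q_le : ∀ t ∈ Set.Icc 0 b, euc (q t) ≤ kb * euc (τ t)
  z_dot_q : ∀ t ∈ Set.Icc 0 b, z t ⬝ᵥ q t ≤ kb * (z t ⬝ᵥ τ t)
  τ_eq : ∀ t ∈ Set.Icc 0 b, τ t = ρ1 • crossProduct ((Q t)ᵀ *ᵥ mI) mI +
    ρ2 • crossProduct ((Q t)ᵀ *ᵥ a t)
      (sat c2hat ((1 - Q t)ᵀ *ᵥ a t - fun i => ξ t (Sum.inr i)))

section Observer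

variable {m : ℕ} {D : Design m} {V : Vehicle} {E : Estimate} {b : ℝ}

theorem Design.Kp_eq (D : Design m) : D.Kp = D.γ • D.K0.toRows₁ := by
  ext i j
  simp [Design.Kp, Design.K, matL, toRows₁, mul_apply, Fintype.sum_sum_type, Matrix.one_apply]

theorem Design.Kv_eq (D : Design m) : D.Kv = D.γ ^ 2 • D.K0.toRows₂ := by
  ext i j
  simp [Design.Kv, Design.K, matL, toRows₂, mul_apply, Fintype.sum_sum_type, Matrix.one_apply]

theorem outErr_eq (t : ℝ) :
    outErr D V E t = D.Cp *ᵥ (V.p t - fun i => E.x t (Sum.inl i)) := by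
  have h : matC D.Cp *ᵥ E.x t = D.Cp *ᵥ fun i => E.x t (Sum.inl i) := by
    conv_lhs => rw [← Sum.elim_comp_inl_inr (E.x t), matC, fromCols_mulVec]
    simp [Function.comp_def]
  rw [outErr, h, mulVec_sub]

/-- The scaled auxiliary error `γ² ζ` in terms of the position and velocity errors. -/
theorem sq_smul_zeta_eq (hγ : 0 < D.γ) (t : ℝ) :
    D.γ ^ 2 • zeta D V E t = Sum.elim
      (D.γ • (V.v t - fun i => E.x t (Sum.inr i))
        - D.γ ^ 2 • ((D.K0.toRows₁ * D.Cp) *ᵥ (V.p t - fun i => E.x t (Sum.inl i))))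
      ((1 - Rtil V E t)ᵀ *ᵥ V.aI t
        - D.γ ^ 2 • ((D.K0.toRows₂ * D.Cp) *ᵥ (V.p t - fun i => E.x t (Sum.inl i)))) := by
  have hinv : (matL D.γ)⁻¹ = fromBlocks (D.γ⁻¹ • 1) 0 0 ((D.γ ^ 2)⁻¹ • 1) := by
    refine inv_eq_right_inv ?_
    rw [matL, fromBlocks_multiply]
    simp [hγ.ne', fromBlocks_one, smul_smul]
  have hx : xtil V E t = Sum.elim (V.p t - fun i => E.x t (Sum.inl i))
      (V.v t - fun i => E.x t (Sum.inr i)) := by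
    ext (i | i) <;> simp [xtil, Vehicle.x]
  have hA : matA - D.K * matC D.Cp
      = fromBlocks (-(D.γ • (D.K0.toRows₁ * D.Cp))) 1 (-(D.γ ^ 2 • (D.K0.toRows₂ * D.Cp))) 0 := by
    rw [matA_sub_eq, ← Design.Kp, ← Design.Kv, D.Kp_eq, D.Kv_eq, Matrix.smul_mul, Matrix.smul_mul]
  rw [zeta, hinv, hx, hA, matB, fromRows_mulVec, fromBlocks_mulVec, zero_mulVec, one_mulVec]
  ext (i | i)
  · simp [fromBlocks_mulVec, neg_mulVec, smul_mulVec]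
    field_simp
    ring
  · simp [fromBlocks_mulVec, neg_mulVec, smul_mulVec]
    field_simp
    ring

/-- Up to `ξ`, the output injection measures `R a_B - R̂ a_B`. Adding `R̂ a_B` would give `a_I`, and
that summand is invisible in the cross product of the innovation. -/
theorem Kv_outErr_eq (hγ : 0 < D.γ) (t : ℝ) :
    D.Kv *ᵥ outErr D V E t = (1 - Rtil V E t)ᵀ *ᵥ V.aI t
      - fun i => (D.γ ^ 2 • zeta D V E t) (Sum.inr i) := by
  rw [sq_smul_zeta_eq hγ, outErr_eq, D.Kv_eq, mulVec_mulVec, Matrix.smul_mul, smul_mulVec]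
  ext i
  simp

theorem hasDerivWithinAt_sumElim {f g : ℝ → V3} {f' g' : V3} {s : Set ℝ} {t : ℝ}
    (hf : HasDerivWithinAt f f' s t) (hg : HasDerivWithinAt g g' s t) :
    HasDerivWithinAt (fun t => (Sum.elim (f t) (g t) : I6 → ℝ)) (Sum.elim f' g') s t := by
  rw [hasDerivWithinAt_pi] at *
  rintro (i | i)
  · exact hf i
  · exact hg i

theorem hasDerivWithinAt_position_error (hE : ∀ t ∈ Set.Icc 0 b, HasDerivWithinAt E.x
      (matA *ᵥ E.x t + matB *ᵥ (D.g • e3 + E.R t *ᵥ V.aB t) + D.K *ᵥ outErr D V E t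
        + σx D V E t) (Set.Icc 0 b) t) (hV : V.IsMotion D.g) {t : ℝ} (ht : t ∈ Set.Icc 0 b) :
    HasDerivWithinAt (fun t => V.p t - fun i => E.x t (Sum.inl i))
      ((V.v t - fun i => E.x t (Sum.inr i)) - D.γ • ((D.K0.toRows₁ * D.Cp) *ᵥ
        (V.p t - fun i => E.x t (Sum.inl i))) - σp D V E t) (Set.Icc 0 b) t := by
  have h1 := (hV.dp t ht.1).mono (Set.Icc_subset_Ici_self : Set.Icc 0 b ⊆ _)
  have h2 := hE t ht
  rw [hasDerivWithinAt_pi] at *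
  intro i
  refine ((h1 i).fun_sub (h2 (Sum.inl i))).congr_deriv ?_
  have h3 : (D.K *ᵥ outErr D V E t) (Sum.inl i) = (D.γ • ((D.K0.toRows₁ * D.Cp) *ᵥ
        (V.p t - fun i => E.x t (Sum.inl i)))) i := by
    rw [show (D.K *ᵥ outErr D V E t) (Sum.inl i) = (D.Kp *ᵥ outErr D V E t) i from rfl,
      D.Kp_eq, outErr_eq, mulVec_mulVec, Matrix.smul_mul, smul_mulVec]
  have h4 : (matA *ᵥ E.x t) (Sum.inl i) = E.x t (Sum.inr i) := by
    rw [matA, fromBlocks_mulVec]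
    simp
  have h5 : (matB *ᵥ (D.g • e3 + E.R t *ᵥ V.aB t)) (Sum.inl i) = 0 := by
    rw [matB, fromRows_mulVec]
    simp
  simp only [Pi.add_apply, Pi.sub_apply, h3, h4, h5, σx, Sum.elim_inl]
  ring

theorem hasDerivWithinAt_velocity_error (hE : ∀ t ∈ Set.Icc 0 b, HasDerivWithinAt E.x
      (matA *ᵥ E.x t + matB *ᵥ (D.g • e3 + E.R t *ᵥ V.aB t) + D.K *ᵥ outErr D V E t
        + σx D V E t) (Set.Icc 0 b) t) (hV : V.IsMotion D.g) {t : ℝ} (ht : t ∈ Set.Icc 0 b) :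
    HasDerivWithinAt (fun t => V.v t - fun i => E.x t (Sum.inr i))
      (V.R t *ᵥ V.aB t - E.R t *ᵥ V.aB t - D.γ ^ 2 • ((D.K0.toRows₂ * D.Cp) *ᵥ
        (V.p t - fun i => E.x t (Sum.inl i))) - D.γ • ((D.K0.toRows₁ * D.Cp) *ᵥ σp D V E t))
      (Set.Icc 0 b) t := by
  have h1 := (hV.dv t ht.1).mono (Set.Icc_subset_Ici_self : Set.Icc 0 b ⊆ _)
  have h2 := hE t ht
  rw [hasDerivWithinAt_pi] at *
  intro i
  refine ((h1 i).fun_sub (h2 (Sum.inr i))).congr_deriv ?_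
  have h3 : (D.K *ᵥ outErr D V E t) (Sum.inr i) = (D.γ ^ 2 • ((D.K0.toRows₂ * D.Cp) *ᵥ
        (V.p t - fun i => E.x t (Sum.inl i)))) i := by
    rw [show (D.K *ᵥ outErr D V E t) (Sum.inr i) = (D.Kv *ᵥ outErr D V E t) i from rfl,
      D.Kv_eq, outErr_eq, mulVec_mulVec, Matrix.smul_mul, smul_mulVec]
  have h4 : (matA *ᵥ E.x t) (Sum.inr i) = 0 := by
    rw [matA, fromBlocks_mulVec]
    simp
  have h5 : (matB *ᵥ (D.g • e3 + E.R t *ᵥ V.aB t)) (Sum.inr i)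
      = (D.g • e3 + E.R t *ᵥ V.aB t) i := by
    rw [matB, fromRows_mulVec]
    simp
  have h6 : σv D V E t = D.γ • ((D.K0.toRows₁ * D.Cp) *ᵥ σp D V E t) := by
    rw [σv, D.Kp_eq, Matrix.smul_mul, smul_mulVec]
  simp only [Pi.add_apply, Pi.sub_apply, h3, h4, h5, σx, Sum.elim_inr, h6]
  ring

/-- On and outside the sphere of radius `c₅ + ε_b` the projected field does not point outward. -/
theorem euc_bias_estimate_le (hc : 0 < D.c5) (hε : 0 < D.εb)
    (hE : ∀ t ∈ Set.Icc 0 b, HasDerivWithinAt E.b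
      (proj D.c5 D.εb (E.b t) (-D.kb • σR D V E t)) (Set.Icc 0 b) t)
    (h0 : euc (E.b 0) ≤ D.c5 + D.εb) : ∀ t ∈ Set.Icc 0 b, euc (E.b t) ≤ D.c5 + D.εb := by
  intro t ht
  have hpos : 0 ≤ D.c5 + D.εb := by linarith
  refine euc_le_of_sq_le hpos ?_
  refine le_of_deriv_nonpos_above (f := fun t => E.b t ⬝ᵥ E.b t)
    (fun t ht => hasDerivWithinAt_dot (hE t ht) (hE t ht)) (fun t ht hle => ?_) ?_ t ht
  · rw [← euc_sq] at hle
    have h1 := dot_proj_nonpos hc hε (E.b t) (-D.kb • σR D V E t) (le_of_sq_le_sq hle (euc_nonneg _))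
    rw [dotProduct_comm _ (E.b t)]
    linarith
  · rw [← euc_sq]
    exact pow_le_pow_left₀ (euc_nonneg _) h0 2

/-- The closed loop of vehicle and observer gives an `ErrorFlow`. -/
theorem exists_errorFlow {c0 c1 c2 c3 c4 : ℝ} (hγ : 0 < D.γ) (hc5 : 0 < D.c5) (hεb : 0 < D.εb)
    (hkb : 0 < D.kb) (hdet : IsUnit (D.K0.toRows₂ * D.Cp).det) (hV : V.IsMotion D.g)
    (hN : V.NonCollinear D.mI c0) (hA : V.BoundedAcc c1 c2 c3) (hB : V.BoundedRate c4 D.c5)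
    {J : Set ℝ} (hE : IsObserver D V E J) (hJ : Set.Icc 0 b ⊆ J)
    (h0 : euc (E.b 0) ≤ D.c5 + D.εb) :
    ∃ F : ErrorFlow (matA - D.K0 * matC D.Cp) D.mI D.ρ1 D.ρ2 D.c2hat D.kb c0 c2 c3 c4
        (2 * D.c5 + D.εb) D.kR D.γ b,
      ∀ t ∈ Set.Icc 0 b, F.Q t = Rtil V E t ∧ euc (F.z t) = euc (btil V E t) ∧
        F.ξ t = D.γ ^ 2 • zeta D V E t := by
  have hsub : Set.Icc 0 b ⊆ Set.Ici 0 := Set.Icc_subset_Ici_self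
  have hRd := fun t (ht : t ∈ Set.Icc 0 b) => hasDerivWithinAt_matrix_mono (hV.dR t ht.1) hsub
  have hEd := fun t (ht : t ∈ Set.Icc 0 b) => hasDerivWithinAt_matrix_mono (hE.dR t (hJ ht)) hJ
  have hbd := fun t (ht : t ∈ Set.Icc 0 b) => (hE.db t (hJ ht)).mono hJ
  have hxd := fun t (ht : t ∈ Set.Icc 0 b) => (hE.dx t (hJ ht)).mono hJ
  have hR := mem_SO3_of_deriv hV.R_init hRd
  have hRh := mem_SO3_of_deriv hE.R_init hEd
  have haI : ∀ t ∈ Set.Icc 0 b, HasDerivWithinAt V.aI (derivWithin V.aI (Set.Ici 0) t)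
      (Set.Icc 0 b) t := fun t ht => ((hA.diff t ht.1).hasDerivWithinAt).mono hsub
  have hσ : ∀ t ∈ Set.Icc 0 b, E.R t *ᵥ (V.ωy t - E.b t + D.kR • σR D V E t)
      = E.R t *ᵥ V.ω t + E.R t *ᵥ btil V E t + D.kR • (E.R t *ᵥ σR D V E t) := by
    intro t ht
    rw [← mulVec_smul, ← mulVec_add, ← mulVec_add, Vehicle.ωy, btil]
    congr 1
    abel
  have hQa : ∀ t ∈ Set.Icc 0 b, (Rtil V E t)ᵀ *ᵥ V.aI t = E.R t *ᵥ V.aB t := by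
    intro t ht
    rw [Rtil, transpose_mul, transpose_transpose, Vehicle.aB, mulVec_mulVec]
  have hQd : ∀ t ∈ Set.Icc 0 b, HasDerivWithinAt (Rtil V E) (-(Rtil V E t *
      skew (E.R t *ᵥ btil V E t + D.kR • (E.R t *ᵥ σR D V E t)))) (Set.Icc 0 b) t := by
    intro t ht
    have h0 := hasDerivWithinAt_mul (hRd t ht) (hasDerivWithinAt_transpose (hEd t ht))
    refine (congrArg (fun X => HasDerivWithinAt (Rtil V E) X (Set.Icc 0 b) t) ?_).mp h0
    have h1 : E.R t *ᵥ btil V E t + D.kR • (E.R t *ᵥ σR D V E t)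
        = E.R t *ᵥ (V.ωy t - E.b t + D.kR • σR D V E t - V.ω t) := by
      rw [mulVec_sub, hσ t ht]
      abel
    have h2 : ∀ x y, skew (x - y) = skew x - skew y := by
      intro x y
      ext i j
      fin_cases i <;> fin_cases j <;> simp [skew] <;> ring
    rw [h1, ← rot_mul_skew_mul (hRh t ht), Rtil, h2, transpose_mul, skew_transpose]
    have h3 := transpose_mul_of_mem (hRh t ht)
    simp only [← Matrix.mul_assoc]
    rw [Matrix.mul_assoc (V.R t) (E.R t)ᵀ (E.R t), h3]
    simp only [Matrix.mul_one, Matrix.mul_sub, Matrix.sub_mul, Matrix.mul_neg, Matrix.neg_mul,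
      Matrix.mul_assoc]
    abel
  have hbtil : ∀ t ∈ Set.Icc 0 b, HasDerivWithinAt (btil V E)
      (-proj D.c5 D.εb (E.b t) (-D.kb • σR D V E t)) (Set.Icc 0 b) t :=
    fun t ht => (hbd t ht).const_sub _
  have hpbound : ∀ t ∈ Set.Icc 0 b, euc (proj D.c5 D.εb (E.b t) (-D.kb • σR D V E t))
      ≤ D.kb * euc (σR D V E t) := by
    intro t ht
    refine (euc_proj_le hc5 hεb _ _).trans_eq ?_
    rw [euc_smul, abs_neg, abs_of_pos hkb]
  have hQm : ∀ t ∈ Set.Icc 0 b, Rtil V E t ∈ specialOrthogonalGroup (Fin 3) ℝ := by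
    intro t ht
    exact mul_mem (hR t ht) (transpose_mem (hRh t ht))
  refine ⟨{ Q := Rtil V E
            a := V.aI
            ad := fun t => derivWithin V.aI (Set.Ici 0) t
            -- Rotating the bias error into the inertial frame lets it enter the equation for `Q`
            -- unconjugated, with the same norm.
            z := fun t => E.R t *ᵥ btil V E t
            τ := fun t => E.R t *ᵥ σR D V E t
            q := fun t => E.R t *ᵥ (-proj D.c5 D.εb (E.b t) (-D.kb • σR D V E t))
            u := fun t => E.R t *ᵥ V.ω t
            ξ := fun t => D.γ ^ 2 • zeta D V E t
            Q_mem := hQm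
            dQ := hQd
            da := haI
            dz := ?_
            dξ := ?_
            cross_a := fun t ht => hN t ht.1
            a_le := fun t ht => hA.upper t ht.1
            ad_le := fun t ht => hA.deriv_le t ht.1
            u_le := ?_
            z_le := ?_
            q_le := ?_
            z_dot_q := ?_
            τ_eq := ?_ }, fun t ht => ⟨rfl, euc_rot (hRh t ht) _, rfl⟩⟩
  · intro t ht
    refine (hasDerivWithinAt_mulVec (hEd t ht) (hbtil t ht)).congr_deriv ?_
    rw [← mulVec_mulVec, skew_mulVec, rot_cross (hRh t ht), hσ t ht]
  · intro t ht
    have hfun : (fun t => D.γ ^ 2 • zeta D V E t) = _ :=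
      funext fun t => sq_smul_zeta_eq (V := V) (E := E) hγ t
    have hp := hasDerivWithinAt_position_error hxd hV ht
    have hv := hasDerivWithinAt_velocity_error hxd hV ht
    have hI : HasDerivWithinAt (fun t => (1 - Rtil V E t)ᵀ) (- -(Rtil V E t * skew
        (E.R t *ᵥ btil V E t + D.kR • (E.R t *ᵥ σR D V E t))))ᵀ (Set.Icc 0 b) t :=
      hasDerivWithinAt_transpose (hasDerivWithinAt_matrix.2 fun i j =>
        (hasDerivWithinAt_matrix.1 (hQd t ht) i j).const_sub ((1 : M3) i j))
    have h1 := hasDerivWithinAt_mulVec hI (haI t ht)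
    have h2 := hasDerivWithinAt_const_mulVec (D.K0.toRows₁ * D.Cp) hp
    have h3 := hasDerivWithinAt_const_mulVec (D.K0.toRows₂ * D.Cp) hp
    rw [hfun]
    refine (hasDerivWithinAt_sumElim ((hv.const_smul D.γ).fun_sub (h2.const_smul (D.γ ^ 2)))
      (h1.fun_sub (h3.const_smul (D.γ ^ 2)))).congr_deriv ?_
    -- The purpose of `σ_p`: its contribution cancels the `k_R` term coming from the derivative of
    -- `(I - Q)ᵀ`, so the forcing of `ξ` is free of the gains.
    have hσp : D.γ ^ 2 • ((D.K0.toRows₂ * D.Cp) *ᵥ σp D V E t)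
        = D.kR • crossProduct (E.R t *ᵥ σR D V E t) (E.R t *ᵥ V.aB t) := by
      have hK : IsUnit (D.Kv * D.Cp).det := by
        rw [D.Kv_eq, Matrix.smul_mul, det_smul]
        exact (isUnit_iff_ne_zero.2 (by positivity)).mul hdet
      rw [← smul_mulVec, ← Matrix.smul_mul, ← D.Kv_eq, σp, mulVec_smul, mulVec_mulVec,
        mul_nonsing_inv _ hK, one_mulVec, skew_mulVec]
    have hRR : V.R t *ᵥ V.aB t - E.R t *ᵥ V.aB t = (1 - Rtil V E t)ᵀ *ᵥ V.aI t := by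
      rw [← hQa t ht, transpose_sub, transpose_one, sub_mulVec, one_mulVec, Vehicle.aB,
        rot_rot_transpose (hR t ht)]
    have hrot : (- -(Rtil V E t * skew (E.R t *ᵥ btil V E t + D.kR • (E.R t *ᵥ σR D V E t))))ᵀ
        *ᵥ V.aI t = -crossProduct (E.R t *ᵥ btil V E t) (E.R t *ᵥ V.aB t)
          - D.kR • crossProduct (E.R t *ᵥ σR D V E t) (E.R t *ᵥ V.aB t) := by
      rw [neg_neg, transpose_mul, ← mulVec_mulVec, skew_transpose, neg_mulVec, skew_mulVec,
        hQa t ht]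
      simp only [map_add, map_smul, LinearMap.add_apply, LinearMap.smul_apply]
      abel
    rw [hrot, hRR, matA_sub_eq, fromBlocks_mulVec, sq_smul_zeta_eq hγ t, hQa t ht]
    simp only [Sum.elim_comp_inl, Sum.elim_comp_inr]
    ext (i | i)
    -- In the position block, `σ_v = K_p C_p σ_p` makes the two innovations cancel.
    · simp only [Sum.elim_inl, Pi.add_apply, Pi.sub_apply, Pi.smul_apply, smul_eq_mul, mulVec_sub,
        mulVec_smul, neg_mulVec, Pi.neg_apply, one_mulVec, Pi.zero_apply]
      ring
    · have h4 := congrFun hσp i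
      simp only [Sum.elim_inr, Pi.add_apply, Pi.sub_apply, Pi.smul_apply, smul_eq_mul, mulVec_sub,
        mulVec_smul, neg_mulVec, Pi.neg_apply, zero_mulVec, Pi.zero_apply] at h4 ⊢
      linear_combination h4
  · intro t ht
    rw [euc_rot (hRh t ht)]
    exact hB.rate t ht.1
  · intro t ht
    rw [euc_rot (hRh t ht), btil]
    have h1 := euc_sub_le V.bω (E.b t)
    have h2 := euc_bias_estimate_le hc5 hεb hbd h0 t ht
    have h3 := hB.bias
    linarith
  · intro t ht
    rw [euc_rot (hRh t ht), euc_rot (hRh t ht), euc_neg]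
    exact hpbound t ht
  · intro t ht
    rw [rot_dot (hRh t ht), rot_dot (hRh t ht)]
    have := dot_proj_ge hc5 hεb (E.b t) (-D.kb • σR D V E t) hB.bias
    rw [dotProduct_smul, smul_eq_mul] at this
    rw [dotProduct_neg, btil]
    linarith
  · intro t ht
    have h1 : E.R t *ᵥ V.mB D.mI t = (Rtil V E t)ᵀ *ᵥ D.mI := by
      rw [Rtil, transpose_mul, transpose_transpose, Vehicle.mB, mulVec_mulVec]
    rw [σR, mulVec_add, mulVec_smul, mulVec_smul, rot_cross (hRh t ht), rot_cross (hRh t ht),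
      rot_rot_transpose (hRh t ht), rot_rot_transpose (hRh t ht), h1, hQa t ht, Kv_outErr_eq hγ]

end Observer

/-- Two directions at least `c₀` from collinear weigh every axis of rotation. -/
theorem exists_weight_le {mI : V3} {c0 c2 ρ1 ρ2 : ℝ} (hc0 : 0 < c0) (hc2 : 0 < c2) (hρ1 : 0 < ρ1)
    (hρ2 : 0 < ρ2) : ∃ cg : ℝ, 0 < cg ∧ ∀ s a : V3, c0 ≤ euc (crossProduct mI a) → euc a ≤ c2 →
      cg * euc s ^ 2 ≤
        ρ1 * euc (crossProduct s mI) ^ 2 + ρ2 * euc (crossProduct s a) ^ 2 := by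
  have hN : 0 < 2 * (4 * c2 ^ 2 / ρ1 + euc mI ^ 2 / ρ2) := by
    have := sq_nonneg (euc mI)
    positivity
  -- Obtained by squaring `c₀‖s‖ ≤ 2c₂‖s × m‖ + ‖m‖‖s × a‖`, with `(x+y)² ≤ 2x² + 2y²`, and
  -- comparing with the weights `ρ₁, ρ₂`.
  refine ⟨c0 ^ 2 / (2 * (4 * c2 ^ 2 / ρ1 + euc mI ^ 2 / ρ2)), by positivity, fun s a h0 h2 => ?_⟩
  have h := euc_mul_euc_cross_le s mI a
  set A := euc (crossProduct s mI)
  set B := euc (crossProduct s a)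
  have hA : 0 ≤ A := euc_nonneg _
  have hB : 0 ≤ B := euc_nonneg _
  have hs := euc_nonneg s
  have hm := euc_nonneg mI
  have h3 : euc s * c0 ≤ 2 * c2 * A + euc mI * B := by
    have h4 := mul_le_mul_of_nonneg_left h0 hs
    have h5 := mul_le_mul_of_nonneg_right h2 hA
    linarith
  have h6 : (euc s * c0) ^ 2 ≤ 2 * ((2 * c2 * A) ^ 2 + (euc mI * B) ^ 2) := by
    refine (pow_le_pow_left₀ (by positivity) h3 2).trans ?_
    nlinarith [sq_nonneg (2 * c2 * A - euc mI * B)]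
  have h7 : 2 * ((2 * c2 * A) ^ 2 + (euc mI * B) ^ 2) ≤
      2 * (4 * c2 ^ 2 / ρ1 + euc mI ^ 2 / ρ2) * (ρ1 * A ^ 2 + ρ2 * B ^ 2) := by
    have e : 2 * (4 * c2 ^ 2 / ρ1 + euc mI ^ 2 / ρ2) * (ρ1 * A ^ 2 + ρ2 * B ^ 2)
        = 2 * ((2 * c2 * A) ^ 2 + (euc mI * B) ^ 2) + 2 * (4 * c2 ^ 2 / ρ1 * (ρ2 * B ^ 2)
          + euc mI ^ 2 / ρ2 * (ρ1 * A ^ 2)) := by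
      field_simp
      ring
    rw [e]
    have : 0 ≤ 4 * c2 ^ 2 / ρ1 * (ρ2 * B ^ 2) + euc mI ^ 2 / ρ2 * (ρ1 * A ^ 2) := by positivity
    linarith
  rw [div_mul_eq_mul_div, div_le_iff₀ hN]
  nlinarith

theorem hasDerivWithinAt_axial {Q : ℝ → M3} {Q' : M3} {s : Set ℝ} {t : ℝ}
    (h : HasDerivWithinAt Q Q' s t) :
    HasDerivWithinAt (fun t => axial (Q t)) (axial Q') s t := by
  rw [hasDerivWithinAt_matrix] at h
  rw [hasDerivWithinAt_pi]
  intro i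
  fin_cases i
  · exact ((h 2 1).sub (h 1 2)).div_const 2
  · exact ((h 0 2).sub (h 2 0)).div_const 2
  · exact ((h 1 0).sub (h 0 1)).div_const 2

theorem euc_comp_inr_le (x : I6 → ℝ) : euc (fun i => x (Sum.inr i)) ≤ euc x := by
  refine euc_le_of_sq_le (euc_nonneg _) ?_
  rw [euc_sq]
  simp only [dotProduct, Fintype.sum_sum_type]
  have : 0 ≤ ∑ i : Fin 3, x (Sum.inl i) * x (Sum.inl i) :=
    Finset.sum_nonneg fun i _ => mul_self_nonneg _
  linarith

theorem euc_elim_zero (x : V3) : euc (Sum.elim (0 : V3) x) = euc x := by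
  refine (sq_eq_sq₀ (euc_nonneg _) (euc_nonneg _)).1 ?_
  rw [euc_sq, euc_sq]
  simp [dotProduct, Fintype.sum_sum_type]

/-! ### Bounds on the attitude innovation -/

namespace ErrorFlow

variable {A0 : Matrix I6 I6 ℝ} {mI : V3} {ρ1 ρ2 c2hat kb c0 c2 c3 c4 cb k γ b : ℝ}
  (F : ErrorFlow A0 mI ρ1 ρ2 c2hat kb c0 c2 c3 c4 cb k γ b) {t : ℝ}

/-- The attitude innovation without translational error. -/
noncomputable def τ0 (t : ℝ) : V3 :=
  ρ1 • crossProduct ((F.Q t)ᵀ *ᵥ mI) mI + ρ2 • crossProduct ((F.Q t)ᵀ *ᵥ F.a t) (F.a t)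

/-- For `ξ = 0` the saturation is inactive, since `‖(I - Q)ᵀa‖ ≤ √8 c₂ < ĉ₂`, and `Qᵀa × (I - Q)ᵀa =
Qᵀa × a`. The minimum keeps both uses: a uniform bound while `ξ` is huge, a linear one afterwards.
-/
theorem euc_τ_sub_τ0_le (hρ2 : 0 < ρ2) (hc2 : 0 < c2) (hc2hat : Real.sqrt 8 * c2 < c2hat)
    (ht : t ∈ Set.Icc 0 b) :
    euc (F.τ t - F.τ0 t) ≤ 2 * ρ2 * c2 * min c2hat (euc (F.ξ t)) := by
  have hQ := F.Q_mem t ht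
  have ha := F.a_le t ht
  have h8 := Real.sqrt_nonneg 8
  have hc : 0 ≤ c2hat := (mul_nonneg h8 hc2.le).trans hc2hat.le
  set y : V3 := fun i => F.ξ t (Sum.inr i)
  have hu : euc ((1 - F.Q t)ᵀ *ᵥ F.a t) ≤ c2hat := by
    refine (euc_one_sub_transpose_mulVec_le hQ _).trans (le_trans ?_ hc2hat.le)
    have h1 := attNorm_le_one hQ
    calc Real.sqrt 8 * attNorm (F.Q t) * euc (F.a t) ≤ Real.sqrt 8 * 1 * c2 := by
          have := euc_nonneg (F.a t)
          gcongr
      _ = Real.sqrt 8 * c2 := by ring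
  have h : F.τ t - F.τ0 t = ρ2 • crossProduct ((F.Q t)ᵀ *ᵥ F.a t)
      (sat c2hat ((1 - F.Q t)ᵀ *ᵥ F.a t - y) - (1 - F.Q t)ᵀ *ᵥ F.a t) := by
    have h1 : (1 - F.Q t)ᵀ *ᵥ F.a t = F.a t - (F.Q t)ᵀ *ᵥ F.a t := by
      rw [transpose_sub, transpose_one, sub_mulVec, one_mulVec]
    rw [F.τ_eq t ht, τ0, map_sub]
    nth_rw 3 [h1]
    rw [map_sub, cross_self]
    module
  have h2 := euc_sat_sub_le hc hu y
  have h3 := euc_cross_le ((F.Q t)ᵀ *ᵥ F.a t)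
      (sat c2hat ((1 - F.Q t)ᵀ *ᵥ F.a t - y) - (1 - F.Q t)ᵀ *ᵥ F.a t)
  rw [euc_rot (transpose_mem hQ)] at h3
  have h4 : min c2hat (euc y) ≤ min c2hat (euc (F.ξ t)) :=
    min_le_min_left _ (euc_comp_inr_le _)
  rw [h, euc_smul, abs_of_pos hρ2]
  have h5 : euc (F.a t) * euc (sat c2hat ((1 - F.Q t)ᵀ *ᵥ F.a t - y) - (1 - F.Q t)ᵀ *ᵥ F.a t)
      ≤ c2 * (2 * min c2hat (euc (F.ξ t))) :=
    mul_le_mul ha (by linarith) (euc_nonneg _) hc2.le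
  nlinarith

theorem axial_dot_τ0 (ht : t ∈ Set.Icc 0 b) : axial (F.Q t) ⬝ᵥ F.τ0 t =
    ρ1 * euc (crossProduct (axial (F.Q t)) mI) ^ 2 +
      ρ2 * euc (crossProduct (axial (F.Q t)) (F.a t)) ^ 2 := by
  rw [τ0, dotProduct_add, dotProduct_smul, dotProduct_smul, axial_dot_rot_cross (F.Q_mem t ht),
    axial_dot_rot_cross (F.Q_mem t ht), smul_eq_mul, smul_eq_mul]

theorem euc_rot_cross_self_le {Q : M3} (hQ : Q ∈ specialOrthogonalGroup (Fin 3) ℝ) (x : V3) :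
    euc (crossProduct (Qᵀ *ᵥ x) x) ≤ 3 * attNorm Q * euc x ^ 2 := by
  have h : crossProduct (Qᵀ *ᵥ x) x = -crossProduct ((1 - Q)ᵀ *ᵥ x) x := by
    rw [transpose_sub, transpose_one, sub_mulVec, one_mulVec, map_sub, LinearMap.sub_apply,
      cross_self]
    abel
  have h8 : Real.sqrt 8 ≤ 3 := Real.sqrt_le_iff.2 ⟨by norm_num, by norm_num⟩
  have he : 0 ≤ attNorm Q := Real.sqrt_nonneg _
  have hx := euc_nonneg x
  rw [h, euc_neg]
  calc _ ≤ euc ((1 - Q)ᵀ *ᵥ x) * euc x := euc_cross_le _ _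
    _ ≤ (Real.sqrt 8 * attNorm Q * euc x) * euc x :=
      mul_le_mul_of_nonneg_right (euc_one_sub_transpose_mulVec_le hQ x) hx
    _ ≤ (3 * attNorm Q * euc x) * euc x := by gcongr
    _ = _ := by ring

theorem euc_τ0_le (hρ1 : 0 < ρ1) (hρ2 : 0 < ρ2) (ht : t ∈ Set.Icc 0 b) :
    euc (F.τ0 t) ≤ 3 * (ρ1 * euc mI ^ 2 + ρ2 * c2 ^ 2) * attNorm (F.Q t) := by
  have hQ := F.Q_mem t ht
  have he : 0 ≤ attNorm (F.Q t) := Real.sqrt_nonneg _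
  have h1 := euc_rot_cross_self_le hQ mI
  have h2 : euc (crossProduct ((F.Q t)ᵀ *ᵥ F.a t) (F.a t)) ≤ 3 * attNorm (F.Q t) * c2 ^ 2 :=
    (euc_rot_cross_self_le hQ _).trans
      (mul_le_mul_of_nonneg_left (pow_le_pow_left₀ (euc_nonneg _) (F.a_le t ht) 2) (by linarith))
  rw [τ0]
  refine (euc_add_le _ _).trans ?_
  rw [euc_smul, euc_smul, abs_of_pos hρ1, abs_of_pos hρ2]
  nlinarith [mul_le_mul_of_nonneg_left h1 hρ1.le, mul_le_mul_of_nonneg_left h2 hρ2.le]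

/-! #### Derivatives along the error flow -/

/-- `|Q|²` is differentiated in trace form, which is linear in `Q`; the square root in `attNorm` is
avoided. -/
theorem hasDerivWithinAt_attNorm_sq (ht : t ∈ Set.Icc 0 b) :
    HasDerivWithinAt (fun t => (3 - (F.Q t).trace) / 4)
      (-(1 / 2) * (axial (F.Q t) ⬝ᵥ (F.z t + k • F.τ t))) (Set.Icc 0 b) t := by
  refine (((hasDerivWithinAt_trace (F.dQ t ht)).const_sub 3).div_const 4).congr_deriv ?_
  rw [trace_neg, trace_mul_skew]
  ring

/-- The attitude potential `½ Σ ρ ‖(I - Q) a‖²`. -/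
noncomputable def pot (t : ℝ) : ℝ :=
  1 / 2 * (ρ1 * (((1 - F.Q t) *ᵥ mI) ⬝ᵥ ((1 - F.Q t) *ᵥ mI)) +
    ρ2 * (((1 - F.Q t) *ᵥ F.a t) ⬝ᵥ ((1 - F.Q t) *ᵥ F.a t)))

theorem hasDerivWithinAt_one_sub_mulVec {f : ℝ → V3} {f' : V3}
    (hf : HasDerivWithinAt f f' (Set.Icc 0 b) t) (ht : t ∈ Set.Icc 0 b) :
    HasDerivWithinAt (fun t => (1 - F.Q t) *ᵥ f t)
      (F.Q t *ᵥ crossProduct (F.z t + k • F.τ t) (f t) + (1 - F.Q t) *ᵥ f') (Set.Icc 0 b) t := by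
  have hI : HasDerivWithinAt (fun t => 1 - F.Q t) (F.Q t * skew (F.z t + k • F.τ t))
      (Set.Icc 0 b) t :=
    hasDerivWithinAt_matrix.2 fun i j =>
      ((hasDerivWithinAt_matrix.1 (F.dQ t ht) i j).const_sub ((1 : M3) i j)).congr_deriv (by simp)
  refine (hasDerivWithinAt_mulVec hI hf).congr_deriv ?_
  rw [← mulVec_mulVec, skew_mulVec]

theorem one_sub_mulVec_dot_rot_cross {Q : M3} (hQ : Q ∈ specialOrthogonalGroup (Fin 3) ℝ)
    (w x : V3) :
    ((1 - Q) *ᵥ x) ⬝ᵥ (Q *ᵥ crossProduct w x) = -(w ⬝ᵥ crossProduct (Qᵀ *ᵥ x) x) := by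
  have h1 : (1 - Q) *ᵥ x = Q *ᵥ (Qᵀ *ᵥ x - x) := by
    rw [mulVec_sub, rot_rot_transpose hQ, sub_mulVec, one_mulVec]
  rw [h1, rot_dot hQ, sub_dotProduct, dot_cross_self w x, triple_product_permutation,
    ← cross_anticomm (Qᵀ *ᵥ x) x, dotProduct_neg]
  ring

/-- Rotating at rate `z + kτ` changes this potential exactly through `τ0`. The resulting `-z·τ0` is
what the adaptation term `z·τ` can cancel, which is why the potential is preferred to `|Q|²`. The
last term is the drift of `a`. -/
theorem hasDerivWithinAt_pot (ht : t ∈ Set.Icc 0 b) :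
    HasDerivWithinAt F.pot (-((F.z t + k • F.τ t) ⬝ᵥ F.τ0 t)
      + ρ2 * (((1 - F.Q t) *ᵥ F.a t) ⬝ᵥ ((1 - F.Q t) *ᵥ F.ad t))) (Set.Icc 0 b) t := by
  have hm := F.hasDerivWithinAt_one_sub_mulVec
    (hasDerivWithinAt_const t (Set.Icc 0 b) mI) ht
  have ha := F.hasDerivWithinAt_one_sub_mulVec (F.da t ht) ht
  have hQ := F.Q_mem t ht
  refine ((((hasDerivWithinAt_dot hm hm).const_mul ρ1).add
    ((hasDerivWithinAt_dot ha ha).const_mul ρ2)).const_mul (1 / 2)).congr_deriv ?_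
  simp only [mulVec_zero, add_zero, add_dotProduct, dotProduct_add,
    dotProduct_comm (F.Q t *ᵥ _) _, dotProduct_comm ((1 - F.Q t) *ᵥ F.ad t) _,
    one_sub_mulVec_dot_rot_cross hQ, τ0, dotProduct_smul, smul_eq_mul, smul_dotProduct]
  ring

theorem hasDerivWithinAt_z_dot (ht : t ∈ Set.Icc 0 b) :
    HasDerivWithinAt (fun t => F.z t ⬝ᵥ F.z t) (2 * (F.z t ⬝ᵥ F.q t)) (Set.Icc 0 b) t := by
  refine (hasDerivWithinAt_dot (F.dz t ht) (F.dz t ht)).congr_deriv ?_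
  rw [dotProduct_comm _ (F.z t), dotProduct_add, dot_cross_self]
  ring

/-- The cross term of the Lyapunov function: near the identity its derivative contains `-‖z‖²`,
which the other terms do not provide. -/
theorem hasDerivWithinAt_axial_dot_z (ht : t ∈ Set.Icc 0 b) :
    HasDerivWithinAt (fun t => axial (F.Q t) ⬝ᵥ F.z t)
      (-(axial (F.Q t * skew (F.z t + k • F.τ t)) ⬝ᵥ F.z t) + axial (F.Q t) ⬝ᵥ
        (crossProduct (F.u t + F.z t + k • F.τ t) (F.z t) + F.q t)) (Set.Icc 0 b) t := by
  refine (hasDerivWithinAt_dot (hasDerivWithinAt_axial (F.dQ t ht)) (F.dz t ht)).congr_deriv ?_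
  have h : ∀ M : M3, axial (-M) = -axial M := by
    intro M
    ext i
    fin_cases i <;> simp [axial] <;> ring
  rw [h, neg_dotProduct]

theorem hasDerivWithinAt_quadratic {P : Matrix I6 I6 ℝ} (hP : Pᵀ = P) (ht : t ∈ Set.Icc 0 b) :
    HasDerivWithinAt (fun t => F.ξ t ⬝ᵥ P *ᵥ F.ξ t)
      (2 * γ * (F.ξ t ⬝ᵥ P *ᵥ (A0 *ᵥ F.ξ t)) + 2 * ((P *ᵥ F.ξ t) ⬝ᵥ Sum.elim (0 : V3)
        ((1 - F.Q t)ᵀ *ᵥ F.ad t - crossProduct (F.z t) ((F.Q t)ᵀ *ᵥ F.a t))))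
      (Set.Icc 0 b) t := by
  refine (hasDerivWithinAt_dot (F.dξ t ht)
    (hasDerivWithinAt_const_mulVec P (F.dξ t ht))).congr_deriv ?_
  have h : ∀ x : I6 → ℝ, F.ξ t ⬝ᵥ P *ᵥ x = (P *ᵥ F.ξ t) ⬝ᵥ x := by
    intro x
    rw [dotProduct_mulVec, ← mulVec_transpose, hP]
  rw [dotProduct_comm _ (P *ᵥ F.ξ t), h, h]
  simp only [dotProduct_add, dotProduct_smul, smul_eq_mul]
  ring

end ErrorFlow

/-! ### Differential inequalities for the translational and attitude errors -/

namespace ErrorFlow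

variable {A0 : Matrix I6 I6 ℝ} {mI : V3} {ρ1 ρ2 c2hat kb c0 c2 c3 c4 cb k γ b : ℝ}
  (F : ErrorFlow A0 mI ρ1 ρ2 c2hat kb c0 c2 c3 c4 cb k γ b) {t : ℝ}

/-- Neither `k` nor `γ` appears here, so `γ` can be chosen after `k` to dominate the forcing. -/
theorem euc_forcing_le (ht : t ∈ Set.Icc 0 b) :
    euc ((1 - F.Q t)ᵀ *ᵥ F.ad t - crossProduct (F.z t) ((F.Q t)ᵀ *ᵥ F.a t)) ≤
      3 * c3 * attNorm (F.Q t) + c2 * euc (F.z t) := by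
  have hQ := F.Q_mem t ht
  have he : 0 ≤ attNorm (F.Q t) := Real.sqrt_nonneg _
  have h8 : Real.sqrt 8 ≤ 3 := Real.sqrt_le_iff.2 ⟨by norm_num, by norm_num⟩
  have h1 : euc ((1 - F.Q t)ᵀ *ᵥ F.ad t) ≤ 3 * attNorm (F.Q t) * c3 := by
    refine (euc_one_sub_transpose_mulVec_le hQ _).trans ?_
    have h := F.ad_le t ht
    have := euc_nonneg (F.ad t)
    gcongr
  have h2 : euc (crossProduct (F.z t) ((F.Q t)ᵀ *ᵥ F.a t)) ≤ euc (F.z t) * c2 := by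
    refine (euc_cross_le _ _).trans ?_
    rw [euc_rot (transpose_mem hQ)]
    exact mul_le_mul_of_nonneg_left (F.a_le t ht) (euc_nonneg _)
  linarith [euc_sub_le ((1 - F.Q t)ᵀ *ᵥ F.ad t) (crossProduct (F.z t) ((F.Q t)ᵀ *ᵥ F.a t))]

theorem quadratic_deriv_le {P : Matrix I6 I6 ℝ} {a p : ℝ} (hγ : 0 < γ) (hA : ∀ x, x ⬝ᵥ P *ᵥ (A0 *ᵥ x) ≤ -a * euc x ^ 2)
    (hp : ∀ x, euc (P *ᵥ x) ≤ p * euc x) (ht : t ∈ Set.Icc 0 b) :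
    2 * γ * (F.ξ t ⬝ᵥ P *ᵥ (A0 *ᵥ F.ξ t)) + 2 * ((P *ᵥ F.ξ t) ⬝ᵥ Sum.elim (0 : V3)
        ((1 - F.Q t)ᵀ *ᵥ F.ad t - crossProduct (F.z t) ((F.Q t)ᵀ *ᵥ F.a t))) ≤
      -2 * a * γ * euc (F.ξ t) ^ 2 +
        2 * p * euc (F.ξ t) * (3 * c3 * attNorm (F.Q t) + c2 * euc (F.z t)) := by
  have h1 := dot_le (P *ᵥ F.ξ t) (Sum.elim (0 : V3)
        ((1 - F.Q t)ᵀ *ᵥ F.ad t - crossProduct (F.z t) ((F.Q t)ᵀ *ᵥ F.a t)))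
  rw [euc_elim_zero] at h1
  have h2 := mul_le_mul (hp (F.ξ t)) (F.euc_forcing_le ht) (euc_nonneg _)
    ((euc_nonneg _).trans (hp (F.ξ t)))
  have h3 := mul_le_mul_of_nonneg_left (hA (F.ξ t)) (by positivity : 0 ≤ 2 * γ)
  linarith

/-- The scaled translational error decays fast, up to a small remainder. -/
theorem euc_ξ_le {P : Matrix I6 I6 ℝ} {a p p' : ℝ} (hγ : 0 < γ) (hc2 : 0 < c2)
    (hc3 : 0 < c3) (hcb : 0 < cb) (ha : 0 < a) (hp1 : 1 ≤ p) (hp'0 : 0 ≤ p') (hP : Pᵀ = P)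
    (hlow : ∀ x, euc x ^ 2 ≤ x ⬝ᵥ P *ᵥ x) (hupp : ∀ x, x ⬝ᵥ P *ᵥ x ≤ p * euc x ^ 2)
    (hA : ∀ x, x ⬝ᵥ P *ᵥ (A0 *ᵥ x) ≤ -a * euc x ^ 2)
    (hp' : ∀ x, euc (P *ᵥ x) ≤ p' * euc x) {r : ℝ} (hr : 0 < r) (h0 : euc (F.ξ 0) ≤ r)
    (ht : t ∈ Set.Icc 0 b) :
    euc (F.ξ t) ≤ r * p * Real.exp (-(a / (2 * p)) * γ * t) +
      p * p' * (3 * c3 + c2 * cb) / a / γ := by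
  have hp0 : 0 < p := by linarith
  set N := 3 * c3 + c2 * cb with hN
  have hNpos : 0 < N := by positivity
  have key := le_exp_mul_add_of_deriv_le (f := fun t => F.ξ t ⬝ᵥ P *ᵥ F.ξ t)
    (a := a * γ / p) (d := p' ^ 2 * N ^ 2 / (a * γ)) (by positivity)
    (fun t ht => F.hasDerivWithinAt_quadratic hP ht) (fun t ht => by
      have h1 := F.quadratic_deriv_le hγ hA hp' ht
      refine h1.trans ?_
      have hx := euc_nonneg (F.ξ t)
      have h2 : 3 * c3 * attNorm (F.Q t) + c2 * euc (F.z t) ≤ N := by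
        have := attNorm_le_one (F.Q_mem t ht)
        have := F.z_le t ht
        nlinarith
      have h3 : 2 * p' * euc (F.ξ t) * (3 * c3 * attNorm (F.Q t) + c2 * euc (F.z t))
          ≤ 2 * p' * euc (F.ξ t) * N := mul_le_mul_of_nonneg_left h2 (by positivity)
      -- Young's inequality spends half of the decay `2aγ‖ξ‖²`; the constant left over is the `d`
      -- given to the Grönwall lemma.
      have h4 : 2 * p' * euc (F.ξ t) * N ≤ a * γ * euc (F.ξ t) ^ 2 + p' ^ 2 * N ^ 2 / (a * γ) := by
        have h5 : a * γ * euc (F.ξ t) ^ 2 + p' ^ 2 * N ^ 2 / (a * γ) - 2 * p' * euc (F.ξ t) * N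
            = (a * γ * euc (F.ξ t) - p' * N) ^ 2 / (a * γ) := by
          field_simp
          ring
        have h6 : 0 ≤ (a * γ * euc (F.ξ t) - p' * N) ^ 2 / (a * γ) := by positivity
        linarith
      have h7 : a * γ / p * (F.ξ t ⬝ᵥ P *ᵥ F.ξ t) ≤ a * γ * euc (F.ξ t) ^ 2 := by
        refine (mul_le_mul_of_nonneg_left (hupp (F.ξ t)) (by positivity)).trans_eq ?_
        field_simp
      linarith) (by positivity) t ht
  have hγt : -(a * γ / p) * t = -(a / (2 * p)) * γ * t + -(a / (2 * p)) * γ * t := by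
    field_simp
    ring
  set X := Real.exp (-(a / (2 * p)) * γ * t)
  have hX : Real.exp (-(a * γ / p) * t) = X ^ 2 := by rw [hγt, Real.exp_add, sq]
  rw [hX] at key
  have hXpos : 0 < X := Real.exp_pos _
  -- `p ≤ p²` is used, here and in `h10`, so that the final square root is exact.
  have h8 : F.ξ 0 ⬝ᵥ P *ᵥ F.ξ 0 ≤ p ^ 2 * r ^ 2 := by
    refine (hupp _).trans ?_
    have := pow_le_pow_left₀ (euc_nonneg _) h0 2
    have h9 : p ≤ p ^ 2 := by nlinarith
    exact mul_le_mul h9 this (sq_nonneg _) (sq_nonneg _)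
  have h10 : p' ^ 2 * N ^ 2 / (a * γ) / (a * γ / p) ≤ (p * p' * N / a / γ) ^ 2 := by
    have e1 : p' ^ 2 * N ^ 2 / (a * γ) / (a * γ / p) = p * (p' * N / a / γ) ^ 2 := by
      field_simp
    have e2 : (p * p' * N / a / γ) ^ 2 = p ^ 2 * (p' * N / a / γ) ^ 2 := by
      field_simp
    rw [e1, e2]
    exact mul_le_mul_of_nonneg_right (by nlinarith) (sq_nonneg _)
  have h11 : 0 ≤ p * p' * N / a / γ := by positivity
  refine le_of_sq_le_sq ?_ (by positivity)
  have h12 := mul_le_mul_of_nonneg_left h8 (sq_nonneg X)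
  have h13 : 0 ≤ r * p * X * (p * p' * N / a / γ) := by positivity
  have h14 := hlow (F.ξ t)
  nlinarith

/-- Only boundedness of `z` is used: the restoring term `k cg ‖s‖` has to beat `cb`, and the `ξ`
term is kept in saturated form. -/
theorem attNorm_sq_deriv_le (hρ2 : 0 < ρ2) (hc2 : 0 < c2)
    (hc2hat : Real.sqrt 8 * c2 < c2hat) (hk : 0 < k) {cg : ℝ}
    (hg : ∀ s a : V3, c0 ≤ euc (crossProduct mI a) → euc a ≤ c2 → cg * euc s ^ 2 ≤
        ρ1 * euc (crossProduct s mI) ^ 2 + ρ2 * euc (crossProduct s a) ^ 2)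
    (ht : t ∈ Set.Icc 0 b) :
    -(1 / 2) * (axial (F.Q t) ⬝ᵥ (F.z t + k • F.τ t)) ≤ 1 / 2 * euc (axial (F.Q t)) *
      (cb - k * cg * euc (axial (F.Q t)) + k * (2 * ρ2 * c2 * min c2hat (euc (F.ξ t)))) := by
  have h1 := neg_le_dot (axial (F.Q t)) (F.z t)
  have h2 := neg_le_dot (axial (F.Q t)) (F.τ t - F.τ0 t)
  have hs := euc_nonneg (axial (F.Q t))
  have h3 := mul_le_mul_of_nonneg_left (F.z_le t ht) hs
  have h4 := mul_le_mul_of_nonneg_left (F.euc_τ_sub_τ0_le hρ2 hc2 hc2hat ht) hs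
  have h5 := hg (axial (F.Q t)) (F.a t) (F.cross_a t ht) (F.a_le t ht)
  rw [← F.axial_dot_τ0 ht] at h5
  rw [dotProduct_sub] at h2
  have h6 : cg * euc (axial (F.Q t)) ^ 2 -
      euc (axial (F.Q t)) * (2 * ρ2 * c2 * min c2hat (euc (F.ξ t))) ≤
      axial (F.Q t) ⬝ᵥ F.τ t := by linarith
  have h7 := mul_le_mul_of_nonneg_left h6 hk.le
  rw [dotProduct_add, dotProduct_smul, smul_eq_mul]
  nlinarith

end ErrorFlow

/-! ### Keeping the attitude error away from half-turns -/

/-- Interpolation of a saturated, fast decaying quantity. -/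
theorem min_le_rpow_quarter {c y0 E g : ℝ} (hc : 0 < c) (hy0 : 0 < y0) (hE : 0 < E) (hg : 0 < g) :
    min c (g ^ 4 * y0 * E ^ 4) ≤ (1 + c ^ 3 * y0) * g * E := by
  set m := min c (g ^ 4 * y0 * E ^ 4)
  have hm0 : 0 ≤ m := le_min hc.le (by positivity)
  have h1 : m ^ 3 ≤ c ^ 3 := pow_le_pow_left₀ hm0 (min_le_left _ _) 3
  have h2 : m ≤ g ^ 4 * y0 * E ^ 4 := min_le_right _ _
  refine le_of_pow_le_pow_left₀ (n := 4) (by norm_num) (by positivity) ?_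
  -- `m⁴ = m³ · m`, with the first factor bounded by the saturation level and the second by the
  -- decaying quantity.
  have h3 : m ^ 4 ≤ c ^ 3 * (g ^ 4 * y0 * E ^ 4) := by
    rw [pow_succ]
    exact mul_le_mul h1 h2 hm0 (by positivity)
  refine h3.trans ?_
  have h4 : c ^ 3 * y0 ≤ (1 + c ^ 3 * y0) ^ 4 := by
    have : 0 < c ^ 3 * y0 := by positivity
    exact (by linarith : c ^ 3 * y0 ≤ 1 + c ^ 3 * y0).trans (le_self_pow₀ (by linarith) (by norm_num))
  calc c ^ 3 * (g ^ 4 * y0 * E ^ 4) = c ^ 3 * y0 * (g ^ 4 * E ^ 4) := by ring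
    _ ≤ (1 + c ^ 3 * y0) ^ 4 * (g ^ 4 * E ^ 4) := mul_le_mul_of_nonneg_right h4 (by positivity)
    _ = _ := by ring

/-- For a large attitude gain and a larger translational gain, the attitude error stays away
from the set of half-turns. -/
theorem exists_gain_attNorm_le {A0 : Matrix I6 I6 ℝ} {mI : V3}
    {ρ1 ρ2 c2hat kb c0 c2 c3 c4 cb cg a p p' ε r : ℝ} {P : Matrix I6 I6 ℝ}
    (hρ2 : 0 < ρ2) (hc2 : 0 < c2) (hc3 : 0 < c3) (hcb : 0 < cb)
    (hc2hat : Real.sqrt 8 * c2 < c2hat) (hcg : 0 < cg)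
    (hg : ∀ s a : V3, c0 ≤ euc (crossProduct mI a) → euc a ≤ c2 → cg * euc s ^ 2 ≤
        ρ1 * euc (crossProduct s mI) ^ 2 + ρ2 * euc (crossProduct s a) ^ 2)
    (ha : 0 < a) (hp1 : 1 ≤ p) (hp'0 : 0 ≤ p') (hP : Pᵀ = P)
    (hlow : ∀ x, euc x ^ 2 ≤ x ⬝ᵥ P *ᵥ x) (hupp : ∀ x, x ⬝ᵥ P *ᵥ x ≤ p * euc x ^ 2)
    (hA : ∀ x, x ⬝ᵥ P *ᵥ (A0 *ᵥ x) ≤ -a * euc x ^ 2)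
    (hp' : ∀ x, euc (P *ᵥ x) ≤ p' * euc x) (hε0 : 0 < ε) (hε1 : ε < 1) (hr : 0 < r) :
    ∃ kmin : ℝ, 0 < kmin ∧ ∀ k, kmin ≤ k → ∃ γmin : ℝ, 1 ≤ γmin ∧ ∀ γ, γmin ≤ γ →
      ∀ (b : ℝ) (F : ErrorFlow A0 mI ρ1 ρ2 c2hat kb c0 c2 c3 c4 cb k γ b),
        attNorm (F.Q 0) ≤ ε → euc (F.ξ 0) ≤ γ ^ 2 * r →
          ∀ t ∈ Set.Icc 0 b, attNorm (F.Q t) ≤ (1 + ε) / 2 := by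
  have hp0 : 0 < p := by linarith
  have hch : 0 < c2hat := (mul_nonneg (Real.sqrt_nonneg _) hc2.le).trans_lt hc2hat
  set ε' := (1 + ε) / 2 with hε'
  have hεε' : ε < ε' := by rw [hε']; linarith
  have hε'1 : ε' < 1 := by rw [hε']; linarith
  have hε'0 : 0 < ε' := hε0.trans hεε'
  have hε'2 : 0 < 1 - ε' ^ 2 := by nlinarith
  -- A lower bound for `‖axial Q‖² = 4|Q|²(1 - |Q|²)` while `ε ≤ |Q| ≤ ε'`.
  set sm := 4 * ε ^ 2 * (1 - ε' ^ 2) with hsm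
  have hsmpos : 0 < sm := by positivity
  set N := p * p' * (3 * c3 + c2 * cb) / a with hN
  have hNpos : 0 ≤ N := by positivity
  set d := 2 * ρ2 * c2 with hd
  have hdpos : 0 < d := by positivity
  set α := a / (2 * p) with hα
  have hαpos : 0 < α := by positivity
  set Dc := 1 + c2hat ^ 3 * (r * p) with hDc
  have hDcpos : 0 < Dc := by positivity
  have hgap : 0 < ε' ^ 2 - ε ^ 2 := by nlinarith
  -- With this threshold the bias error costs at most half of `k cg sm`.
  refine ⟨2 * cb / (cg * sm), by positivity, fun k hk => ?_⟩
  have hkpos : 0 < k := lt_of_lt_of_le (by positivity) hk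
  set G := 4 * k * d * Dc / α with hG
  have hGpos : 0 < G := by positivity
  -- The second summand makes the `O(1/γ)` remainder of `ξ` cost at most a quarter of `k cg sm`; the
  -- third makes the barrier rise by at most `ε'² - ε²`.
  refine ⟨1 + 4 * d * N / (cg * sm) + (G / (ε' ^ 2 - ε ^ 2)) ^ 2, ?_, fun γ hγ b F hQ0 hξ0 => ?_⟩
  · have h1 : 0 ≤ 4 * d * N / (cg * sm) := by positivity
    have h2 := sq_nonneg (G / (ε' ^ 2 - ε ^ 2))
    linarith
  have hγ1 : 1 ≤ γ ∧ 4 * d * N / (cg * sm) ≤ γ ∧ (G / (ε' ^ 2 - ε ^ 2)) ^ 2 ≤ γ := by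
    have h1 : 0 ≤ 4 * d * N / (cg * sm) := by positivity
    have h2 := sq_nonneg (G / (ε' ^ 2 - ε ^ 2))
    exact ⟨by linarith, by linarith, by linarith⟩
  obtain ⟨hγ1, hγ2, hγ3⟩ := hγ1
  have hγpos : 0 < γ := by linarith
  -- `w ^ 2 = γ`
  set w := Real.sqrt γ with hw
  have hwpos : 0 < w := Real.sqrt_pos.2 hγpos
  have hw2 : w ^ 2 = γ := Real.sq_sqrt hγpos.le
  have hGw : G / w ≤ ε' ^ 2 - ε ^ 2 := by
    have h1 : G / (ε' ^ 2 - ε ^ 2) ≤ w := Real.le_sqrt_of_sq_le hγ3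
    rw [div_le_iff₀ hgap] at h1
    rw [div_le_iff₀ hwpos]
    linarith
  -- The barrier for `|Q|²`. Its slope is the bound `k d Dc √γ exp(-αγt/4)` on the transient push of
  -- the saturated error, so its total rise is `G/√γ`.
  set B : ℝ → ℝ := fun t => ε ^ 2 + G / w * (1 - Real.exp (-(α / 4 * γ) * t)) with hB
  have hBle : ∀ t, B t ≤ ε' ^ 2 := by
    intro t
    have h1 := Real.exp_pos (-(α / 4 * γ) * t)
    have h2 : 0 < G / w := by positivity
    have h3 : G / w * (1 - Real.exp (-(α / 4 * γ) * t)) ≤ G / w :=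
      mul_le_of_le_one_right h2.le (by linarith)
    simp only [hB]
    linarith
  have hBge : ∀ t, 0 ≤ t → ε ^ 2 ≤ B t := by
    intro t ht
    have h1 : Real.exp (-(α / 4 * γ) * t) ≤ 1 := Real.exp_le_one_iff.2 (by
      have : 0 ≤ α / 4 * γ * t := by positivity
      linarith)
    have h2 : 0 ≤ G / w * (1 - Real.exp (-(α / 4 * γ) * t)) :=
      mul_nonneg (by positivity) (by linarith)
    simp only [hB]
    linarith
  have hB' : ∀ t, HasDerivAt B (k * d * Dc * w * Real.exp (-(α / 4 * γ) * t)) t := by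
    intro t
    have h1 : HasDerivAt (fun t => Real.exp (-(α / 4 * γ) * t))
        (Real.exp (-(α / 4 * γ) * t) * (-(α / 4 * γ))) t := by
      simpa using ((hasDerivAt_id t).const_mul (-(α / 4 * γ))).exp
    refine (((h1.const_sub 1).const_mul (G / w)).const_add (ε ^ 2)).congr_deriv ?_
    rw [hG, ← hw2]
    field_simp
  have hV : ∀ t ∈ Set.Icc 0 b, attNorm (F.Q t) ^ 2 = (3 - (F.Q t).trace) / 4 :=
    fun t ht => attNorm_sq (F.Q_mem t ht)
  intro t ht
  have h00 : (0 : ℝ) ∈ Set.Icc 0 b := ⟨le_rfl, ht.1.trans ht.2⟩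
  -- The strict slope inequality is needed only at contact `|Q|² = B t`, where `ε ≤ |Q| ≤ ε'` and
  -- the axial vector is bounded below.
  have key := image_le_of_deriv_right_lt_deriv_boundary
    (f := fun t => (3 - (F.Q t).trace) / 4) (a := 0) (b := b) (B := B)
    (fun t ht => (F.hasDerivWithinAt_attNorm_sq ht).continuousWithinAt)
    (fun t ht => hasDerivWithinAt_Ici_of_Icc ht
      (F.hasDerivWithinAt_attNorm_sq (Set.Ico_subset_Icc_self ht))) (by
      simp only [hB, mul_zero, Real.exp_zero, sub_self, add_zero]
      rw [← hV 0 h00]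
      exact pow_le_pow_left₀ (Real.sqrt_nonneg _) hQ0 2) hB' (fun t ht' heq => by
      have ht := Set.Ico_subset_Icc_self ht'
      refine (F.attNorm_sq_deriv_le hρ2 hc2 hc2hat hkpos hg ht).trans_lt ?_
      rw [← hV t ht] at heq
      have hs0 := euc_nonneg (axial (F.Q t))
      have hs2 := euc_axial_sq (F.Q_mem t ht)
      set s := euc (axial (F.Q t))
      have h1 := hBle t
      have h2 := hBge t ht.1
      have hss : sm ≤ s ^ 2 := by
        rw [hs2, heq, hsm]
        have h4 : (ε ^ 2) * (1 - ε' ^ 2) ≤ B t * (1 - B t) :=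
          mul_le_mul h2 (by linarith) hε'2.le (by linarith [sq_nonneg ε])
        linarith
      have hs1 : s ≤ 1 := euc_axial_le_one (F.Q_mem t ht)
      have hsm' : sm ≤ s := hss.trans (pow_le_of_le_one hs0 hs1 two_ne_zero)
      have hspos : 0 < s := hsmpos.trans_le hsm'
      have hk1 : 2 * cb ≤ k * (cg * sm) := by
        rwa [div_le_iff₀ (by positivity)] at hk
      have hk2 : k * (cg * sm) ≤ k * (cg * s) := by gcongr
      -- bound of the saturated translational error
      have hx := F.euc_ξ_le hγpos hc2 hc3 hcb ha hp1 hp'0 hP hlow hupp hA hp'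
        (by positivity : 0 < γ ^ 2 * r) hξ0 ht
      rw [← hα, ← hN] at hx
      have hexp : Real.exp (-α * γ * t) = Real.exp (-(α / 4 * γ) * t) ^ 4 := by
        rw [← Real.exp_nat_mul]
        congr 1
        push_cast
        ring
      set X := Real.exp (-(α / 4 * γ) * t)
      have hX : 0 < X := Real.exp_pos _
      have hmin : min c2hat (euc (F.ξ t)) ≤ Dc * w * X + N / γ := by
        have h5 := min_le_rpow_quarter hch (by positivity : 0 < r * p) hX hwpos
        have h6 : w ^ 4 * (r * p) * X ^ 4 = γ ^ 2 * r * p * Real.exp (-α * γ * t) := by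
          rw [hexp, ← hw2]
          ring
        rw [h6] at h5
        have h7 : 0 ≤ N / γ := by positivity
        rcases le_total c2hat (γ ^ 2 * r * p * Real.exp (-α * γ * t)) with h8 | h8
        · rw [min_eq_left h8] at h5
          linarith [min_le_left c2hat (euc (F.ξ t))]
        · rw [min_eq_right h8] at h5
          linarith [min_le_right c2hat (euc (F.ξ t))]
      have hNγ : d * (N / γ) ≤ cg * sm / 4 := by
        rw [div_le_iff₀ (by positivity)] at hγ2
        rw [← mul_div_assoc, div_le_iff₀ hγpos]
        linarith
      have h9 : k * (d * min c2hat (euc (F.ξ t))) ≤ k * (d * (Dc * w * X)) + k * (cg * sm / 4) := by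
        have h10 := mul_le_mul_of_nonneg_left hmin hdpos.le
        have h11 : d * min c2hat (euc (F.ξ t)) ≤ d * (Dc * w * X) + cg * sm / 4 := by linarith
        have := mul_le_mul_of_nonneg_left h11 hkpos.le
        linarith
      have h12 : 0 < k * (cg * sm) := by positivity
      have h13 : cb - k * cg * s + k * (d * min c2hat (euc (F.ξ t))) < k * (d * (Dc * w * X)) := by
        linarith
      have h14 : 0 < k * (d * (Dc * w * X)) := by positivity
      calc _ < 1 / 2 * s * (k * (d * (Dc * w * X))) :=
            mul_lt_mul_of_pos_left h13 (by linarith)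
        _ ≤ 1 * (k * (d * (Dc * w * X))) :=
            mul_le_mul_of_nonneg_right (by linarith) h14.le
        _ = _ := by ring) ht
  simp only [← hV t ht] at key
  exact le_of_sq_le_sq (key.trans (hBle t)) hε'0.le

/-- Choice of the weight of the cross term and of the gain in a composite Lyapunov function. -/
theorem exists_cross_weight {κ A1 A2 A3 A4 B1 B2 a μ0 : ℝ} (hκ : 0 < κ)
    (hA3 : 0 ≤ A3) (ha : 0 < a) (hμ0 : 0 < μ0) :
    ∃ μ : ℝ, 0 < μ ∧ μ ≤ μ0 ∧ ∃ γmin : ℝ, 1 ≤ γmin ∧ ∃ d : ℝ, 0 < d ∧ ∀ γ, γmin ≤ γ →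
      ∀ e β x : ℝ, 0 ≤ e → 0 ≤ β → 0 ≤ x →
        -κ * e ^ 2 + μ * (-β ^ 2 + A1 * e * β + A2 * x * β + A3 * e ^ 2 + A4 * e * x)
          - a * γ * x ^ 2 + x * (B1 * e + B2 * β) ≤ -d * (e ^ 2 + β ^ 2 + x ^ 2) := by
  have hden : 0 < A1 ^ 2 + 2 * A3 + 1 := by positivity
  -- Keeps the `e²` cost of the cross term, `μ(A1²/2 + A3)`, below `κ/2`.
  set μ := min μ0 (κ / (A1 ^ 2 + 2 * A3 + 1)) with hμ
  have hμpos : 0 < μ := lt_min hμ0 (by positivity)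
  have hμκ : μ * (A1 ^ 2 + 2 * A3 + 1) ≤ κ := by
    have := min_le_right μ0 (κ / (A1 ^ 2 + 2 * A3 + 1))
    rwa [← hμ, le_div_iff₀ hden] at this
  set J1 := B1 + μ * A4 with hJ1
  set J2 := B2 + μ * A2 with hJ2
  -- The quotients in the threshold are the costs in `x²` of splitting the couplings by Young's
  -- inequality, at the price of `κ/4` in `e²` and `μ/4` in `β²`; the `+ 1` leaves decay in `x²`.
  refine ⟨μ, hμpos, min_le_left _ _, 1 + (J1 ^ 2 / κ + J2 ^ 2 / μ + 1) / a, ?_,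
    min (κ / 4) (min (μ / 4) 1), by positivity, fun γ hγ e β x he hβ hx => ?_⟩
  · have : 0 ≤ (J1 ^ 2 / κ + J2 ^ 2 / μ + 1) / a := by positivity
    linarith
  have hγa : J1 ^ 2 / κ + J2 ^ 2 / μ + 1 ≤ a * γ := by
    have h : (J1 ^ 2 / κ + J2 ^ 2 / μ + 1) / a ≤ γ := by linarith
    rw [div_le_iff₀ ha] at h
    linarith
  have h1 : x * (J1 * e) ≤ κ / 4 * e ^ 2 + J1 ^ 2 / κ * x ^ 2 := by
    have h : κ / 4 * e ^ 2 + J1 ^ 2 / κ * x ^ 2 - x * (J1 * e)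
        = (κ * e / 2 - J1 * x) ^ 2 / κ := by
      field_simp
      ring
    have : 0 ≤ (κ * e / 2 - J1 * x) ^ 2 / κ := by positivity
    linarith
  have h2 : x * (J2 * β) ≤ μ / 4 * β ^ 2 + J2 ^ 2 / μ * x ^ 2 := by
    have h : μ / 4 * β ^ 2 + J2 ^ 2 / μ * x ^ 2 - x * (J2 * β)
        = (μ * β / 2 - J2 * x) ^ 2 / μ := by
      field_simp
      ring
    have : 0 ≤ (μ * β / 2 - J2 * x) ^ 2 / μ := by positivity
    linarith
  have h3 : A1 * e * β ≤ β ^ 2 / 2 + A1 ^ 2 / 2 * e ^ 2 := by nlinarith [sq_nonneg (A1 * e - β)]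
  have h4 := mul_le_mul_of_nonneg_left h3 hμpos.le
  have h5 := mul_le_mul_of_nonneg_right hμκ (sq_nonneg e)
  have h6 := mul_le_mul_of_nonneg_right hγa (sq_nonneg x)
  have h7 : min (κ / 4) (min (μ / 4) 1) * e ^ 2 ≤ κ / 4 * e ^ 2 :=
    mul_le_mul_of_nonneg_right (min_le_left _ _) (sq_nonneg e)
  have h8 : min (κ / 4) (min (μ / 4) 1) * β ^ 2 ≤ μ / 4 * β ^ 2 :=
    mul_le_mul_of_nonneg_right ((min_le_right _ _).trans (min_le_left _ _)) (sq_nonneg β)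
  have h9 : min (κ / 4) (min (μ / 4) 1) * x ^ 2 ≤ 1 * x ^ 2 :=
    mul_le_mul_of_nonneg_right ((min_le_right _ _).trans (min_le_right _ _)) (sq_nonneg x)
  have h10 : 0 ≤ μ * e ^ 2 := by positivity
  have h11 : x * (B1 * e + B2 * β) + μ * (A2 * x * β + A4 * e * x)
      = x * (J1 * e) + x * (J2 * β) := by
    rw [hJ1, hJ2]
    ring
  linarith

/-! ### The composite Lyapunov function -/

namespace ErrorFlow

variable {A0 : Matrix I6 I6 ℝ} {mI : V3} {ρ1 ρ2 c2hat kb c0 c2 c3 c4 cb k γ b : ℝ}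
  (F : ErrorFlow A0 mI ρ1 ρ2 c2hat kb c0 c2 c3 c4 cb k γ b) {t : ℝ}

theorem euc_τ_le (hρ1 : 0 < ρ1) (hρ2 : 0 < ρ2) (hc2 : 0 < c2)
    (hc2hat : Real.sqrt 8 * c2 < c2hat) (ht : t ∈ Set.Icc 0 b) :
    euc (F.τ t) ≤ 3 * (ρ1 * euc mI ^ 2 + ρ2 * c2 ^ 2) * attNorm (F.Q t)
      + 2 * ρ2 * c2 * euc (F.ξ t) := by
  have h1 := F.euc_τ0_le hρ1 hρ2 ht
  have h2 := F.euc_τ_sub_τ0_le hρ2 hc2 hc2hat ht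
  have h3 := mul_le_mul_of_nonneg_left (min_le_right c2hat (euc (F.ξ t)))
    (by positivity : 0 ≤ 2 * ρ2 * c2)
  have h4 := euc_add_le (F.τ t - F.τ0 t) (F.τ0 t)
  rw [sub_add_cancel] at h4
  linarith

/-- Since `axial (Q [w]_×)` is `w` up to `4|Q|‖w‖`, the leading term is `-‖z‖²`. Everything else
becomes quadratic in the three error sizes, the cubic `|Q|‖z‖²` through `‖z‖ ≤ cb`. -/
theorem cross_deriv_le (hk : 0 < k) (hkb : 0 < kb) {Cτ d : ℝ}
    (hτ : euc (F.τ t) ≤ Cτ * attNorm (F.Q t) + d * euc (F.ξ t)) (ht : t ∈ Set.Icc 0 b) :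
    -(axial (F.Q t * skew (F.z t + k • F.τ t)) ⬝ᵥ F.z t) + axial (F.Q t) ⬝ᵥ
        (crossProduct (F.u t + F.z t + k • F.τ t) (F.z t) + F.q t) ≤
      -euc (F.z t) ^ 2 + (7 * k * Cτ + 6 * cb + 2 * c4) * attNorm (F.Q t) * euc (F.z t)
        + 7 * k * d * euc (F.ξ t) * euc (F.z t) + 2 * kb * Cτ * attNorm (F.Q t) ^ 2
        + 2 * kb * d * attNorm (F.Q t) * euc (F.ξ t) := by
  have hQ := F.Q_mem t ht
  have hs := euc_axial_le hQ
  have hs0 := euc_nonneg (axial (F.Q t))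
  have he1 := attNorm_le_one hQ
  have he0 : 0 ≤ attNorm (F.Q t) := Real.sqrt_nonneg _
  have hw : euc (F.z t + k • F.τ t) ≤ euc (F.z t) + k * euc (F.τ t) := by
    refine (euc_add_le _ _).trans_eq ?_
    rw [euc_smul, abs_of_pos hk]
  have hΩ : euc (F.u t + F.z t + k • F.τ t) ≤ c4 + euc (F.z t) + k * euc (F.τ t) := by
    have h1 := euc_add_le (F.u t + F.z t) (k • F.τ t)
    have h2 := euc_add_le (F.u t) (F.z t)
    rw [euc_smul, abs_of_pos hk] at h1
    linarith [F.u_le t ht]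
  have hq := F.q_le t ht
  have hzb := F.z_le t ht
  have hz0 := euc_nonneg (F.z t)
  have hx0 := euc_nonneg (F.ξ t)
  have hτ0 := euc_nonneg (F.τ t)
  have h1 : -(axial (F.Q t * skew (F.z t + k • F.τ t)) ⬝ᵥ F.z t) ≤
      -euc (F.z t) ^ 2 + k * euc (F.τ t) * euc (F.z t) +
        4 * attNorm (F.Q t) * (euc (F.z t) + k * euc (F.τ t)) * euc (F.z t) := by
    have h2 := neg_le_dot (axial (F.Q t * skew (F.z t + k • F.τ t)) - (F.z t + k • F.τ t)) (F.z t)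
    have h3 := neg_le_dot (F.τ t) (F.z t)
    have h4 := (euc_axial_mul_skew_sub_le hQ (F.z t + k • F.τ t)).trans
      (mul_le_mul_of_nonneg_left hw (by positivity))
    have h5 := mul_le_mul_of_nonneg_right h4 hz0
    have h6 := mul_le_mul_of_nonneg_left h3 hk.le
    rw [sub_dotProduct, add_dotProduct, smul_dotProduct, smul_eq_mul, ← euc_sq] at h2
    linarith
  have h2 : axial (F.Q t) ⬝ᵥ (crossProduct (F.u t + F.z t + k • F.τ t) (F.z t) + F.q t) ≤
      2 * attNorm (F.Q t) * ((c4 + euc (F.z t) + k * euc (F.τ t)) * euc (F.z t)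
        + kb * euc (F.τ t)) := by
    refine (dot_le _ _).trans (mul_le_mul hs ?_ (euc_nonneg _) (by positivity))
    refine (euc_add_le _ _).trans (add_le_add ((euc_cross_le _ _).trans ?_) hq)
    exact mul_le_mul_of_nonneg_right hΩ hz0
  set e := attNorm (F.Q t)
  set β := euc (F.z t)
  set x := euc (F.ξ t)
  set T := euc (F.τ t)
  -- Collecting terms gives `7 = 1 + 4 + 2` copies of `k T β` and `6 = 4 + 2` copies of `e β²`.
  have h3 : e * (k * T * β) ≤ k * T * β := mul_le_of_le_one_left (by positivity) he1
  have h4 : e * β * β ≤ e * β * cb := mul_le_mul_of_nonneg_left hzb (by positivity)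
  have h5 : k * β * T ≤ k * β * (Cτ * e + d * x) := mul_le_mul_of_nonneg_left hτ (by positivity)
  have h6 : kb * e * T ≤ kb * e * (Cτ * e + d * x) := mul_le_mul_of_nonneg_left hτ (by positivity)
  linarith

/-- Decay of attitude potential and bias error. -/
theorem energy_deriv_le (hk : 0 < k) (hkb : 0 < kb) (hρ1 : 0 < ρ1) (hρ2 : 0 < ρ2)
    (hc2 : 0 < c2) (hc2hat : Real.sqrt 8 * c2 < c2hat) {cg ε : ℝ} (hcg : 0 < cg)
    (hg : ∀ s a : V3, c0 ≤ euc (crossProduct mI a) → euc a ≤ c2 → cg * euc s ^ 2 ≤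
        ρ1 * euc (crossProduct s mI) ^ 2 + ρ2 * euc (crossProduct s a) ^ 2)
    (hkε : 9 * ρ2 * c2 * c3 ≤ k * (2 * cg ^ 2 * (1 - ε ^ 2)))
    (hQε : attNorm (F.Q t) ≤ ε) (ht : t ∈ Set.Icc 0 b) :
    -((F.z t + k • F.τ t) ⬝ᵥ F.τ0 t)
      + ρ2 * (((1 - F.Q t) *ᵥ F.a t) ⬝ᵥ ((1 - F.Q t) *ᵥ F.ad t))
      + 1 / (2 * kb) * (2 * (F.z t ⬝ᵥ F.q t)) ≤
      -(k * (2 * cg ^ 2 * (1 - ε ^ 2))) * attNorm (F.Q t) ^ 2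
        + euc (F.ξ t) * (k * (2 * ρ2 * c2) * (3 * (ρ1 * euc mI ^ 2 + ρ2 * c2 ^ 2)) *
            attNorm (F.Q t) + 2 * ρ2 * c2 * euc (F.z t)) := by
  have hQ := F.Q_mem t ht
  have he0 : 0 ≤ attNorm (F.Q t) := Real.sqrt_nonneg _
  have hz0 := euc_nonneg (F.z t)
  have hx0 := euc_nonneg (F.ξ t)
  have h0 := euc_nonneg (F.τ0 t)
  have hs0 := euc_nonneg (axial (F.Q t))
  have hδ : euc (F.τ t - F.τ0 t) ≤ 2 * ρ2 * c2 * euc (F.ξ t) :=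
    (F.euc_τ_sub_τ0_le hρ2 hc2 hc2hat ht).trans
      (mul_le_mul_of_nonneg_left (min_le_right _ _) (by positivity))
  have hτ0 := F.euc_τ0_le hρ1 hρ2 ht
  -- the bias error
  have h1 : 1 / (2 * kb) * (2 * (F.z t ⬝ᵥ F.q t)) ≤ F.z t ⬝ᵥ F.τ t := by
    have h := F.z_dot_q t ht
    rw [show 1 / (2 * kb) * (2 * (F.z t ⬝ᵥ F.q t)) = (F.z t ⬝ᵥ F.q t) / kb by field_simp,
      div_le_iff₀ hkb]
    linarith
  -- the variation of the apparent acceleration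
  have h2 : ((1 - F.Q t) *ᵥ F.a t) ⬝ᵥ ((1 - F.Q t) *ᵥ F.ad t) ≤
      9 * c2 * c3 * attNorm (F.Q t) ^ 2 := by
    have h8 : Real.sqrt 8 ≤ 3 := Real.sqrt_le_iff.2 ⟨by norm_num, by norm_num⟩
    have h3 : euc ((1 - F.Q t) *ᵥ F.a t) ≤ 3 * attNorm (F.Q t) * c2 := by
      refine (euc_one_sub_mulVec_le hQ _).trans ?_
      have h := F.a_le t ht
      have := euc_nonneg (F.a t)
      gcongr
    have h4 : euc ((1 - F.Q t) *ᵥ F.ad t) ≤ 3 * attNorm (F.Q t) * c3 := by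
      refine (euc_one_sub_mulVec_le hQ _).trans ?_
      have h := F.ad_le t ht
      have := euc_nonneg (F.ad t)
      gcongr
    refine (dot_le _ _).trans ((mul_le_mul h3 h4 (euc_nonneg _) (by positivity)).trans_eq ?_)
    ring
  -- the innovation dominates the attitude error
  have h3 : 4 * cg ^ 2 * (1 - ε ^ 2) * attNorm (F.Q t) ^ 2 ≤ euc (F.τ0 t) ^ 2 := by
    have h4 := hg (axial (F.Q t)) (F.a t) (F.cross_a t ht) (F.a_le t ht)
    rw [← F.axial_dot_τ0 ht] at h4
    have h5 := dot_le (axial (F.Q t)) (F.τ0 t)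
    have h6 : cg * euc (axial (F.Q t)) ≤ euc (F.τ0 t) := by
      rcases eq_or_lt_of_le hs0 with hs | hs
      · rw [← hs, mul_zero]
        exact h0
      · refine le_of_mul_le_mul_left ?_ hs
        linarith
    have h7 := pow_le_pow_left₀ (by positivity) h6 2
    rw [mul_pow, euc_axial_sq hQ] at h7
    have h8 : attNorm (F.Q t) ^ 2 ≤ ε ^ 2 := pow_le_pow_left₀ he0 hQε 2
    have h9 : 0 ≤ 4 * cg ^ 2 * attNorm (F.Q t) ^ 2 := by positivity
    have h10 := mul_le_mul_of_nonneg_left (by linarith : 1 - ε ^ 2 ≤ 1 - attNorm (F.Q t) ^ 2) h9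
    linarith
  -- The cancellation between potential and adaptation: `z` survives only against `τ - τ0`, which is
  -- controlled by `ξ`.
  have h4 : -((F.z t + k • F.τ t) ⬝ᵥ F.τ0 t) + F.z t ⬝ᵥ F.τ t =
      F.z t ⬝ᵥ (F.τ t - F.τ0 t) - k * euc (F.τ0 t) ^ 2 - k * ((F.τ t - F.τ0 t) ⬝ᵥ F.τ0 t) := by
    simp only [add_dotProduct, smul_dotProduct, dotProduct_sub, sub_dotProduct, smul_eq_mul, euc_sq]
    ring
  have h5 : F.z t ⬝ᵥ (F.τ t - F.τ0 t) ≤ euc (F.z t) * (2 * ρ2 * c2 * euc (F.ξ t)) :=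
    (dot_le _ _).trans (mul_le_mul_of_nonneg_left hδ hz0)
  have h6 : -((F.τ t - F.τ0 t) ⬝ᵥ F.τ0 t) ≤ (2 * ρ2 * c2 * euc (F.ξ t)) *
      (3 * (ρ1 * euc mI ^ 2 + ρ2 * c2 ^ 2) * attNorm (F.Q t)) := by
    have h7 := neg_le_dot (F.τ t - F.τ0 t) (F.τ0 t)
    have h8 := mul_le_mul hδ hτ0 h0 (by positivity)
    linarith
  have h7 := mul_le_mul_of_nonneg_left h6 hk.le
  have h8 := mul_le_mul_of_nonneg_left h3 hk.le
  have h9 := mul_le_mul_of_nonneg_left h2 hρ2.le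
  -- Half of the dissipation `k‖τ0‖²` pays for the variation of `a`.
  have h10 := mul_le_mul_of_nonneg_right hkε (sq_nonneg (attNorm (F.Q t)))
  linarith

theorem pot_le (hρ1 : 0 < ρ1) (hρ2 : 0 < ρ2) (ht : t ∈ Set.Icc 0 b) :
    F.pot t ≤ 4 * (ρ1 * euc mI ^ 2 + ρ2 * c2 ^ 2) * attNorm (F.Q t) ^ 2 := by
  have hQ := F.Q_mem t ht
  have h : ∀ x, euc ((1 - F.Q t) *ᵥ x) ^ 2 ≤ 8 * attNorm (F.Q t) ^ 2 * euc x ^ 2 := by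
    intro x
    refine (pow_le_pow_left₀ (euc_nonneg _) (euc_one_sub_mulVec_le hQ x) 2).trans_eq ?_
    rw [mul_pow, mul_pow, Real.sq_sqrt (by norm_num)]
  have h1 := mul_le_mul_of_nonneg_left (h mI) hρ1.le
  have h2 := mul_le_mul_of_nonneg_left (h (F.a t)) hρ2.le
  have h3 : ρ2 * (8 * attNorm (F.Q t) ^ 2 * euc (F.a t) ^ 2) ≤
      ρ2 * (8 * attNorm (F.Q t) ^ 2 * c2 ^ 2) := by
    have h4 := pow_le_pow_left₀ (euc_nonneg _) (F.a_le t ht) 2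
    gcongr
  rw [pot, ← euc_sq, ← euc_sq]
  linarith

/-- `‖(I - Q)a‖` dominates `‖s × a‖`, and the weighted squares of the latter dominate `‖s‖² =
4|Q|²(1 - |Q|²)`; the bound on `|Q|` keeps the last factor positive. -/
theorem le_pot (hρ1 : 0 < ρ1) (hρ2 : 0 < ρ2) {cg ε : ℝ} (hcg : 0 < cg)
    (hg : ∀ s a : V3, c0 ≤ euc (crossProduct mI a) → euc a ≤ c2 → cg * euc s ^ 2 ≤
        ρ1 * euc (crossProduct s mI) ^ 2 + ρ2 * euc (crossProduct s a) ^ 2)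
    (hQε : attNorm (F.Q t) ≤ ε) (ht : t ∈ Set.Icc 0 b) :
    2 * cg * (1 - ε ^ 2) * attNorm (F.Q t) ^ 2 ≤ F.pot t := by
  have hQ := F.Q_mem t ht
  have he0 : 0 ≤ attNorm (F.Q t) := Real.sqrt_nonneg _
  have h4 := hg (axial (F.Q t)) (F.a t) (F.cross_a t ht) (F.a_le t ht)
  rw [euc_axial_sq hQ] at h4
  have h1 := mul_le_mul_of_nonneg_left
    (pow_le_pow_left₀ (euc_nonneg _) (euc_axial_cross_le hQ mI) 2) hρ1.le
  have h2 := mul_le_mul_of_nonneg_left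
    (pow_le_pow_left₀ (euc_nonneg _) (euc_axial_cross_le hQ (F.a t)) 2) hρ2.le
  have h8 : attNorm (F.Q t) ^ 2 ≤ ε ^ 2 := pow_le_pow_left₀ he0 hQε 2
  have h9 : 0 ≤ 2 * cg * attNorm (F.Q t) ^ 2 := by positivity
  have h10 := mul_le_mul_of_nonneg_left (by linarith : 1 - ε ^ 2 ≤ 1 - attNorm (F.Q t) ^ 2) h9
  rw [pot, ← euc_sq, ← euc_sq]
  linarith

end ErrorFlow

/-- Away from half-turns, high gains make the error flow exponentially stable. -/
theorem exists_gain_exp_decay {A0 : Matrix I6 I6 ℝ} {mI : V3}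
    {ρ1 ρ2 c2hat kb c0 c2 c3 c4 cb cg a p p' ε : ℝ} {P : Matrix I6 I6 ℝ}
    (hkb : 0 < kb) (hρ1 : 0 < ρ1) (hρ2 : 0 < ρ2) (hc2 : 0 < c2) (hc3 : 0 < c3) (hc4 : 0 < c4)
    (hcb : 0 < cb) (hc2hat : Real.sqrt 8 * c2 < c2hat) (hcg : 0 < cg)
    (hg : ∀ s a : V3, c0 ≤ euc (crossProduct mI a) → euc a ≤ c2 → cg * euc s ^ 2 ≤
        ρ1 * euc (crossProduct s mI) ^ 2 + ρ2 * euc (crossProduct s a) ^ 2)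
    (ha : 0 < a) (hp1 : 1 ≤ p) (hP : Pᵀ = P)
    (hlow : ∀ x, euc x ^ 2 ≤ x ⬝ᵥ P *ᵥ x) (hupp : ∀ x, x ⬝ᵥ P *ᵥ x ≤ p * euc x ^ 2)
    (hA : ∀ x, x ⬝ᵥ P *ᵥ (A0 *ᵥ x) ≤ -a * euc x ^ 2)
    (hp' : ∀ x, euc (P *ᵥ x) ≤ p' * euc x) (hε0 : 0 < ε) (hε1 : ε < 1) :
    ∃ kmin : ℝ, 0 < kmin ∧ ∀ k, kmin ≤ k → ∃ γmin : ℝ, 1 ≤ γmin ∧ ∃ K lam : ℝ, 0 < K ∧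
      0 < lam ∧ ∀ γ, γmin ≤ γ →
      ∀ (b : ℝ) (F : ErrorFlow A0 mI ρ1 ρ2 c2hat kb c0 c2 c3 c4 cb k γ b),
        (∀ t ∈ Set.Icc 0 b, attNorm (F.Q t) ≤ ε) → ∀ t ∈ Set.Icc 0 b,
          attNorm (F.Q t) ^ 2 + euc (F.z t) ^ 2 + euc (F.ξ t) ^ 2 ≤ K * Real.exp (-lam * t) *
            (attNorm (F.Q 0) ^ 2 + euc (F.z 0) ^ 2 + euc (F.ξ 0) ^ 2) := by
  have hε2 : 0 < 1 - ε ^ 2 := by nlinarith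
  set κ0 := 2 * cg ^ 2 * (1 - ε ^ 2) with hκ0
  have hκ0pos : 0 < κ0 := by positivity
  refine ⟨9 * ρ2 * c2 * c3 / κ0, by positivity, fun k hk => ?_⟩
  have hkpos : 0 < k := lt_of_lt_of_le (by positivity) hk
  rw [div_le_iff₀ hκ0pos] at hk
  have hm2 := sq_nonneg (euc mI)
  set Cw := ρ1 * euc mI ^ 2 + ρ2 * c2 ^ 2 with hCw
  have hCwpos : 0 < Cw := by positivity
  set d := 2 * ρ2 * c2 with hd
  have hdpos : 0 < d := by positivity
  set wl := 2 * cg * (1 - ε ^ 2) with hwl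
  have hwlpos : 0 < wl := by positivity
  -- With `μ ≤ μ0` the cross term uses at most half of the lower bounds for the potential and for
  -- the bias term, so `L` is equivalent to `S`.
  set μ0 := min (wl / 2) (1 / (4 * kb)) with hμ0
  have hμ0pos : 0 < μ0 := lt_min (by positivity) (by positivity)
  obtain ⟨μ, hμ, hμle, γmin, hγmin, dd, hdd, hkey⟩ := exists_cross_weight
    (κ := k * κ0) (A1 := 7 * k * (3 * Cw) + 6 * cb + 2 * c4) (A2 := 7 * k * d)
    (A3 := 2 * kb * (3 * Cw)) (A4 := 2 * kb * d)
    (B1 := k * d * (3 * Cw) + 2 * p' * (3 * c3)) (B2 := d + 2 * p' * c2) (a := 2 * a) (μ0 := μ0)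
    (by positivity) (by positivity) (by positivity) hμ0pos
  have hμ1 : μ ≤ wl / 2 := hμle.trans (min_le_left _ _)
  have hμ2 : μ ≤ 1 / (4 * kb) := hμle.trans (min_le_right _ _)
  set ℓ := min (wl / 2) (min (1 / (4 * kb)) 1) with hℓ
  have hℓpos : 0 < ℓ := lt_min (by positivity) (lt_min (by positivity) one_pos)
  -- A crude common upper constant: the sum of the separate ones.
  set u := 4 * Cw + 1 / (2 * kb) + μ + p with hu
  have hupos : 0 < u := by positivity
  refine ⟨γmin, hγmin, u / ℓ, dd / u, by positivity, by positivity, fun γ hγ b F hQε => ?_⟩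
  have hγpos : 0 < γ := by linarith
  set L : ℝ → ℝ := fun t => F.pot t + 1 / (2 * kb) * (F.z t ⬝ᵥ F.z t)
    + μ * (axial (F.Q t) ⬝ᵥ F.z t) + F.ξ t ⬝ᵥ P *ᵥ F.ξ t with hL
  set S : ℝ → ℝ := fun t => attNorm (F.Q t) ^ 2 + euc (F.z t) ^ 2 + euc (F.ξ t) ^ 2 with hS
  have hcross : ∀ t ∈ Set.Icc 0 b,
      |axial (F.Q t) ⬝ᵥ F.z t| ≤ attNorm (F.Q t) ^ 2 + euc (F.z t) ^ 2 := by
    intro t ht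
    refine (abs_dot_le _ _).trans ?_
    have h1 := mul_le_mul_of_nonneg_right (euc_axial_le (F.Q_mem t ht)) (euc_nonneg (F.z t))
    nlinarith [sq_nonneg (attNorm (F.Q t) - euc (F.z t))]
  have hSL : ∀ t ∈ Set.Icc 0 b, ℓ * S t ≤ L t := by
    intro t ht
    have h1 := F.le_pot hρ1 hρ2 hcg hg (hQε t ht) ht
    have h2 := mul_le_mul_of_nonneg_left (neg_le_of_abs_le (hcross t ht)) hμ.le
    have h3 := hlow (F.ξ t)
    have e1 : ℓ * attNorm (F.Q t) ^ 2 ≤ wl / 2 * attNorm (F.Q t) ^ 2 :=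
      mul_le_mul_of_nonneg_right (min_le_left _ _) (sq_nonneg _)
    have e2 : ℓ * euc (F.z t) ^ 2 ≤ 1 / (4 * kb) * euc (F.z t) ^ 2 :=
      mul_le_mul_of_nonneg_right ((min_le_right _ _).trans (min_le_left _ _)) (sq_nonneg _)
    have e3 : ℓ * euc (F.ξ t) ^ 2 ≤ 1 * euc (F.ξ t) ^ 2 :=
      mul_le_mul_of_nonneg_right ((min_le_right _ _).trans (min_le_right _ _)) (sq_nonneg _)
    have e4 := mul_le_mul_of_nonneg_right hμ1 (sq_nonneg (attNorm (F.Q t)))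
    have e5 := mul_le_mul_of_nonneg_right hμ2 (sq_nonneg (euc (F.z t)))
    have e6 : 1 / (2 * kb) * euc (F.z t) ^ 2 = 2 * (1 / (4 * kb) * euc (F.z t) ^ 2) := by
      field_simp
      ring
    simp only [hL, hS]
    rw [← euc_sq (F.z t), e6]
    linarith
  have hLS : ∀ t ∈ Set.Icc 0 b, L t ≤ u * S t := by
    intro t ht
    have h1 := F.pot_le hρ1 hρ2 ht
    have h2 := mul_le_mul_of_nonneg_left (le_of_abs_le (hcross t ht)) hμ.le
    have h3 := hupp (F.ξ t)
    have e1 := sq_nonneg (attNorm (F.Q t))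
    have e2 := sq_nonneg (euc (F.z t))
    have e3 := sq_nonneg (euc (F.ξ t))
    have f1 : 0 ≤ (1 / (2 * kb) + p) * attNorm (F.Q t) ^ 2 := by positivity
    have f2 : 0 ≤ (4 * Cw + p) * euc (F.z t) ^ 2 := by positivity
    have f3 : 0 ≤ (4 * Cw + 1 / (2 * kb) + μ) * euc (F.ξ t) ^ 2 := by positivity
    simp only [hL, hS, hu]
    rw [← euc_sq (F.z t)]
    linarith
  have hLd := fun t (ht : t ∈ Set.Icc 0 b) =>
    (((F.hasDerivWithinAt_pot ht).add ((F.hasDerivWithinAt_z_dot ht).const_mul (1 / (2 * kb)))).add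
      ((F.hasDerivWithinAt_axial_dot_z ht).const_mul μ)).add (F.hasDerivWithinAt_quadratic hP ht)
  intro t ht
  have hdecay := le_exp_mul_add_of_deriv_le (f := L) (a := dd / u) (d := 0) (by positivity) hLd
    (fun t ht => by
      have h1 := F.energy_deriv_le hkpos hkb hρ1 hρ2 hc2 hc2hat hcg hg hk (hQε t ht) ht
      have h2 := F.cross_deriv_le hkpos hkb
        (F.euc_τ_le hρ1 hρ2 hc2 hc2hat ht) ht
      have h3 := F.quadratic_deriv_le hγpos hA hp' ht
      have h4 := mul_le_mul_of_nonneg_left h2 hμ.le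
      have h5 := hkey γ hγ (attNorm (F.Q t)) (euc (F.z t)) (euc (F.ξ t)) (Real.sqrt_nonneg _)
        (euc_nonneg _) (euc_nonneg _)
      have h6 : dd / u * L t ≤ dd * S t := by
        refine (mul_le_mul_of_nonneg_left (hLS t ht) (by positivity)).trans_eq ?_
        field_simp
      simp only [hS] at h6
      linarith) le_rfl t ht
  have h00 : (0 : ℝ) ∈ Set.Icc 0 b := ⟨le_rfl, ht.1.trans ht.2⟩
  have h1 := hSL t ht
  have h2 := mul_le_mul_of_nonneg_left (hLS 0 h00) (Real.exp_pos (-(dd / u) * t)).le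
  rw [zero_div, add_zero] at hdecay
  change S t ≤ u / ℓ * Real.exp (-(dd / u) * t) * S 0
  rw [show u / ℓ * Real.exp (-(dd / u) * t) * S 0 = Real.exp (-(dd / u) * t) * (u * S 0) / ℓ by
    field_simp, le_div_iff₀ hℓpos]
  linarith

/-! ### Assembly of the theorem -/

/-- Makes `K_v C_p` invertible, so that `σ_p` is a genuine solution of the cancellation equation. A
kernel vector `x` of the block would extend to `(x, K₀ₚ C_p x)` in the kernel of `A - K₀ C`,
contradicting the strict Lyapunov inequality. -/
theorem IsHurwitz.isUnit_det_block {m : ℕ} {Cp : Matrix (Fin m) (Fin 3) ℝ}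
    {K0 : Matrix I6 (Fin m) ℝ} (h : IsHurwitz (matA - K0 * matC Cp)) :
    IsUnit (K0.toRows₂ * Cp).det := by
  obtain ⟨P, a, p, ha, -, -, -, -, hA⟩ := h.exists_lyapunov
  rw [isUnit_iff_ne_zero]
  intro h0
  obtain ⟨x, hx0, hx⟩ := exists_mulVec_eq_zero_iff.2 h0
  have h1 := hA (Sum.elim x ((K0.toRows₁ * Cp) *ᵥ x))
  have h2 : (matA - K0 * matC Cp) *ᵥ Sum.elim x ((K0.toRows₁ * Cp) *ᵥ x) = 0 := by
    rw [matA_sub_eq, fromBlocks_mulVec]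
    simp only [Sum.elim_comp_inl, Sum.elim_comp_inr, neg_mulVec, one_mulVec, zero_mulVec, hx,
      neg_add_cancel, neg_zero, add_zero]
    ext (i | i) <;> rfl
  rw [h2, mulVec_zero, dotProduct_zero] at h1
  have h3 : euc (Sum.elim x ((K0.toRows₁ * Cp) *ᵥ x)) ^ 2 = 0 :=
    le_antisymm (by nlinarith) (sq_nonneg _)
  rw [euc_sq] at h3
  have h4 := dotProduct_self_eq_zero.1 h3
  exact hx0 (funext fun i => congrFun h4 (Sum.inl i))

theorem Icc_subset_timeIco {T : EReal} {t : ℝ} (ht : t ∈ timeIco T) :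
    Set.Icc 0 t ⊆ timeIco T :=
  fun _ hs => ⟨hs.1, (EReal.coe_le_coe_iff.2 hs.2).trans_lt ht.2⟩

/-- From quadratic decay with the scaled translational error to decay of the sum of norms. -/
theorem sum_le_exp_of_sq_le {K lam γ t x e β x0 e0 β0 : ℝ} (hK : 0 < K) (hγ : 1 ≤ γ)
    (hx0 : 0 ≤ x0) (he0 : 0 ≤ e0) (hβ0 : 0 ≤ β0)
    (h : e ^ 2 + β ^ 2 + (γ ^ 2 * x) ^ 2 ≤
      K * Real.exp (-lam * t) * (e0 ^ 2 + β0 ^ 2 + (γ ^ 2 * x0) ^ 2)) :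
    x + e + β ≤ (1 + 3 * K * γ ^ 4) * Real.exp (-(lam / 2) * t) * (x0 + e0 + β0) := by
  have hexp : Real.exp (-lam * t) = Real.exp (-(lam / 2) * t) ^ 2 := by
    rw [sq, ← Real.exp_add]
    congr 1
    ring
  rw [hexp] at h
  set X := Real.exp (-(lam / 2) * t)
  have hX : 0 < X := Real.exp_pos _
  have hγ4 : 1 ≤ γ ^ 4 := one_le_pow₀ hγ
  have hγ0 : 0 < γ := by linarith
  refine le_of_sq_le_sq ?_ (by positivity)
  have h1 : (x + e + β) ^ 2 ≤ 3 * (e ^ 2 + β ^ 2 + x ^ 2) := by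
    nlinarith [sq_nonneg (x - e), sq_nonneg (x - β), sq_nonneg (e - β)]
  have h2 : x ^ 2 ≤ (γ ^ 2 * x) ^ 2 := by
    rw [mul_pow, ← pow_mul]
    exact le_mul_of_one_le_left (sq_nonneg x) hγ4
  have h3 : e0 ^ 2 + β0 ^ 2 + (γ ^ 2 * x0) ^ 2 ≤ γ ^ 4 * (x0 + e0 + β0) ^ 2 := by
    have h4 : e0 ^ 2 + β0 ^ 2 + x0 ^ 2 ≤ (x0 + e0 + β0) ^ 2 := by
      nlinarith [mul_nonneg hx0 he0, mul_nonneg hx0 hβ0, mul_nonneg he0 hβ0]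
    have h5 := mul_le_mul_of_nonneg_left h4 (by positivity : 0 ≤ γ ^ 4)
    have h6 := mul_le_mul_of_nonneg_right hγ4 (by positivity : 0 ≤ e0 ^ 2 + β0 ^ 2)
    linarith
  have h7 := mul_le_mul_of_nonneg_left h3 (by positivity : 0 ≤ K * X ^ 2)
  -- `1 + y` stands for the square root of `y = 3Kγ⁴`: the 3 comes from squaring a sum of three
  -- terms, `γ⁴` from undoing the scaling of `ζ`.
  have h8 : 3 * K * γ ^ 4 ≤ (1 + 3 * K * γ ^ 4) ^ 2 := by
    have : 0 < 3 * K * γ ^ 4 := by positivity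
    nlinarith
  have h9 := mul_le_mul_of_nonneg_right h8 (by positivity : 0 ≤ X ^ 2 * (x0 + e0 + β0) ^ 2)
  rw [mul_pow, mul_pow]
  linarith

end NavObs

open NavObs
theorem theorem1 {m : ℕ} (g : ℝ)
    (Cp : Matrix (Fin m) (Fin 3) ℝ) (hCp : Cp.rank = 3)
    (mI : V3)
    -- constants of the assumptions on the vehicle
    (c0 c1 c2 c3 c4 c5 : ℝ) (hc0 : 0 < c0) (hc1 : 0 < c1) (hc2 : 0 < c2) (hc3 : 0 < c3)
    (hc4 : 0 < c4) (hc5 : 0 < c5)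
    -- design parameters
    (K0 : Matrix I6 (Fin m) ℝ) (hK0 : IsHurwitz (matA - K0 * matC Cp))
    (kb ρ1 ρ2 εb c2hat : ℝ) (hkb : 0 < kb) (hρ1 : 0 < ρ1) (hρ2 : 0 < ρ2) (hεb : 0 < εb)
    (hc2hat : Real.sqrt 8 * c2 < c2hat)
    -- size of the set of initial errors
    (ε : ℝ) (hε : ε ∈ Set.Ioo (1 / 2 : ℝ) 1) (r : ℝ) (hr : 0 < r) :
    ∃ kRs : ℝ, 0 < kRs ∧ ∃ γs : ℝ → ℝ, (∀ k, 1 ≤ γs k) ∧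
      ∀ kR, kRs ≤ kR → ∀ γ, γs kR ≤ γ →
        ∃ M K lam : ℝ, 0 < K ∧ 0 < lam ∧
          ∀ D : Design m, D = ⟨g, Cp, mI, c5, K0, kb, ρ1, ρ2, εb, c2hat, kR, γ⟩ →
          ∀ V : Vehicle, V.IsMotion g → V.NonCollinear mI c0 → V.BoundedAcc c1 c2 c3 →
            V.BoundedRate c4 c5 →
          ∀ (T : EReal) (E : Estimate), IsObserver D V E (timeIco T) →
            euc (zeta D V E 0) ≤ r → attNorm (Rtil V E 0) ≤ ε → euc (E.b 0) ≤ c5 + εb →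
            ∀ t ∈ timeIco T,
              err D V E t ≤ M ∧ err D V E t ≤ K * Real.exp (-lam * t) * err D V E 0 := by
  obtain ⟨hε0, hε1⟩ := hε
  have hε0' : 0 < ε := by linarith
  obtain ⟨P, a, p, ha, hp1, hP, hlow, hupp, hA⟩ := hK0.exists_lyapunov
  obtain ⟨p', hp'0, hp'⟩ := exists_euc_mulVec_le P
  obtain ⟨cg, hcg, hg⟩ := exists_weight_le (mI := mI) hc0 hc2 hρ1 hρ2
  have hcb : 0 < 2 * c5 + εb := by positivity
  obtain ⟨k1, hk1, hinv⟩ := exists_gain_attNorm_le (kb := kb) (c4 := c4) hρ2 hc2 hc3 hcb hc2hat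
    hcg hg ha hp1 hp'0 hP hlow hupp hA hp' hε0' hε1 hr
  -- Decay is requested on the larger region `|Q| ≤ (1 + ε)/2`, in which the previous step confines
  -- the attitude error.
  obtain ⟨k2, hk2, hexp⟩ := exists_gain_exp_decay (ε := (1 + ε) / 2) hkb hρ1 hρ2 hc2 hc3 hc4 hcb
    hc2hat hcg hg ha hp1 hP hlow hupp hA hp' (by linarith) (by linarith)
  choose! γ1 hγ1 hinv using hinv
  choose! γ2 hγ2 Kd lam hKd hlam hexp using hexp
  -- The chosen `γ1`, `γ2` are controlled only above their thresholds in `k`; the outer `max 1`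
  -- gives `1 ≤ γs k` for every `k`.
  refine ⟨max k1 k2, lt_max_of_lt_left hk1, fun k => max 1 (max (γ1 k) (γ2 k)),
    fun k => le_max_left _ _, fun k hk γ hγ => ?_⟩
  have hk1' : k1 ≤ k := (le_max_left _ _).trans hk
  have hk2' : k2 ≤ k := (le_max_right _ _).trans hk
  have hγ_one : 1 ≤ γ := (le_max_left _ _).trans hγ
  have hγ1' : γ1 k ≤ γ := (le_max_left _ _).trans ((le_max_right _ _).trans hγ)
  have hγ2' : γ2 k ≤ γ := (le_max_right _ _).trans ((le_max_right _ _).trans hγ)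
  have hγpos : 0 < γ := by linarith
  have hK := hKd k hk2'
  have hl := hlam k hk2'
  refine ⟨(1 + 3 * Kd k * γ ^ 4) * (r + ε + (2 * c5 + εb)), 1 + 3 * Kd k * γ ^ 4, lam k / 2,
    by positivity, by positivity, ?_⟩
  rintro D rfl V hV hN hBA hBR T E hE hζ hR hb t ht
  -- The error flow is taken on `[0, t]` for the given `t`; all gains and rates were fixed
  -- beforehand.
  obtain ⟨F, hF⟩ := exists_errorFlow
    (D := ⟨g, Cp, mI, c5, K0, kb, ρ1, ρ2, εb, c2hat, k, γ⟩) (b := t) (c0 := c0) (c1 := c1) (c2 := c2) (c3 := c3)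
    (c4 := c4) hγpos hc5 hεb hkb hK0.isUnit_det_block hV hN hBA hBR hE (Icc_subset_timeIco ht) hb
  have h00 : (0 : ℝ) ∈ Set.Icc 0 t := ⟨le_rfl, ht.1⟩
  have htt : t ∈ Set.Icc 0 t := ⟨ht.1, le_rfl⟩
  obtain ⟨hQ0, hz0, hξ0⟩ := hF 0 h00
  obtain ⟨hQt, hzt, hξt⟩ := hF t htt
  have hx : ∀ x : I6 → ℝ, euc (γ ^ 2 • x) = γ ^ 2 * euc x := by
    intro x
    rw [euc_smul, abs_of_pos (by positivity)]
  have hatt := hinv k hk1' γ hγ1' t F (by rwa [hQ0]) (by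
    rw [hξ0, hx]
    exact mul_le_mul_of_nonneg_left hζ (by positivity))
  have hdec := hexp k hk2' γ hγ2' t F hatt t htt
  rw [hQ0, hz0, hξ0, hQt, hzt, hξt, hx, hx] at hdec
  have hfin := sum_le_exp_of_sq_le hK hγ_one (euc_nonneg _) (Real.sqrt_nonneg _)
    (euc_nonneg _) hdec
  refine ⟨hfin.trans ?_, hfin⟩
  have hb0 := F.z_le 0 h00
  rw [hz0] at hb0
  have hX : Real.exp (-(lam k / 2) * t) ≤ 1 := Real.exp_le_one_iff.2 (by
    have := mul_nonneg (half_pos hl).le ht.1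
    linarith)
  have hKpos : 0 < 1 + 3 * Kd k * γ ^ 4 := by positivity
  refine mul_le_mul (mul_le_of_le_one_right hKpos.le hX) (add_le_add (add_le_add hζ hR) hb0)
    ?_ hKpos.le
  have h1 := euc_nonneg (zeta ⟨g, Cp, mI, c5, K0, kb, ρ1, ρ2, εb, c2hat, k, γ⟩ V E 0)
  have h2 : 0 ≤ attNorm (Rtil V E 0) := Real.sqrt_nonneg _
  have h3 := euc_nonneg (btil V E 0)
  positivity
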